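/- Let $\mathbb{K}$ be an algebraically closed field of characteristic zero and let $X$ be a normal irreducible affine variety over $\mathbb{K}$ with an effective regular action of the one-dimensional torus $\mathbb{G}_m$. A regular action $\mathbb{G}_a\times X\to X$ is called compatible if the image of $\mathbb{G}_m$ normalizes the image of $\mathbb{G}_a$ in $\mathrm{Aut}(X)$ and there is a non-empty open subset $U\subseteq X$ such that $\mathbb{G}_a\cdot x=\overline{\mathbb{G}_m\cdot x}$ for all $x\in U$. Then there exists a compatible $\mathbb{G}_a$-action on $X$ if and only if $X$ contains a prime divisor (an irreducible closed subset of codimension one) that is fixed by $\mathbb{G}_m$ pointwise. Moreover, let $A=\mathbb{K}[X]=\bigoplus_{i\in\mathbb{Z}}A_i$, where $A_i=\{f\in A: f(t\cdot x)=t^if(x)\text{ for all }t\in\mathbb{G}_m,\ x\in X\}$. If $X$ contains a prime divisor fixed by $\mathbb{G}_m$ pointwise, then there is a locally nilpotent derivation $\delta$ of $A$ that is homogeneous with respect to this grading (for some $d\in\mathbb{Z}$, $\delta(A_i)\subseteq A_{i+d}$ for all $i$) and satisfies $\ker\delta=A_0$, such that the $\mathbb{G}_a$-action on $X$ given by $f(s\cdot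 x)=(\exp(s\delta)f)(x)$ is compatible. -/

import Mathlib

open scoped LaurentPolynomial Polynomial

/-- The set of points of the affine variety over an algebraically closed field `K` whose algebra
of regular functions is `A`: the `K`-algebra homomorphisms `A → K`. -/
def Points (K A : Type*) [Field K] [CommRing A] [Algebra K A] : Type _ := A →ₐ[K] K

namespace Points

variable {K A : Type*} [Field K] [CommRing A] [Algebra K A]

/-- Evaluation of regular functions at a point, as a ring homomorphism. -/
def evalHom (x : Points K A) : A →+* K := AlgHom.toRingHom (show A →ₐ[K] K from x)

/-- The value `f(x)` of the regular function `f` at the point `x`. -/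
def value (f : A) (x : Points K A) : K := x.evalHom f

/-- The Zariski topology: closed sets are the common zero sets of families of regular functions. -/
instance zariskiTopology : TopologicalSpace (Points K A) :=
  TopologicalSpace.induced
    (fun x : Points K A => (⟨RingHom.ker x.evalHom, RingHom.ker_isPrime _⟩ : PrimeSpectrum A))
    inferInstance

theorem isClosed_iff_exists_zeroSet (Z : Set (Points K A)) :
    IsClosed Z ↔ ∃ S : Set A, Z = {x | ∀ f ∈ S, value f x = 0} := by
  rw [isClosed_induced_iff]
  constructor
  · rintro ⟨T, hT, rfl⟩
    obtain ⟨S, rfl⟩ := (PrimeSpectrum.isClosed_iff_zeroLocus T).1 hT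
    exact ⟨S, rfl⟩
  · rintro ⟨S, rfl⟩
    exact ⟨PrimeSpectrum.zeroLocus S, PrimeSpectrum.isClosed_zeroLocus S, rfl⟩

end Points

/-- A regular action of the one-dimensional torus `𝔾ₘ` on the affine variety `X` with algebra of
regular functions `A`: an action of the group `Kˣ` on the points of `X` whose action map
`𝔾ₘ × X → X` is a morphism, i.e. pulls back every regular function `f` on `X` to a regular function
on `𝔾ₘ × X`, that is, to an element of `A[T;T⁻¹]`. -/
structure GmAction (K A : Type*) [Field K] [CommRing A] [Algebra K A] where
  /-- The action on points. -/
  act : Kˣ →* Equiv.Perm (Points K A)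
  regular : ∀ f : A, ∃ F : A[T;T⁻¹], ∀ (t : Kˣ) (x : Points K A),
    Points.value f (act t x) = LaurentPolynomial.eval₂ x.evalHom t F

/-- A regular action of the additive group `𝔾ₐ` on the affine variety `X` with algebra of
regular functions `A`: an action of the group `(K, +)` on the points of `X` whose action map
`𝔾ₐ × X → X` is a morphism, i.e. pulls back every regular function `f` on `X` to a regular function
on `𝔾ₐ × X`, that is, to an element of `A[T]`. -/
structure GaAction (K A : Type*) [Field K] [CommRing A] [Algebra K A] where
  /-- The action on points. -/
  act : Multiplicative K →* Equiv.Perm (Points K A)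
  regular : ∀ f : A, ∃ F : A[X], ∀ (s : K) (x : Points K A),
    Points.value f (act (Multiplicative.ofAdd s) x) = Polynomial.eval₂ x.evalHom s F

section

variable {K A : Type*} [Field K] [CommRing A] [Algebra K A]

namespace GmAction

/-- The orbit of the point `x`. -/
def orbit (ρ : GmAction K A) (x : Points K A) : Set (Points K A) := Set.range fun t => ρ.act t x

/-- The action is effective: only `1` acts trivially. -/
def IsEffective (ρ : GmAction K A) : Prop := Function.Injective ρ.act

/-- The component `A_i` of the grading of `A` defined by the action: the functions `f` such that
`f(t • x) = t ^ i * f(x)` for all `t` and `x`. -/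
def weightSpace (ρ : GmAction K A) (i : ℤ) : Submodule K A where
  carrier := {f | ∀ (t : Kˣ) (x : Points K A),
    Points.value f (ρ.act t x) = ((t ^ i : Kˣ) : K) * Points.value f x}
  zero_mem' := by intro t x; simp [Points.value]
  add_mem' := by
    intro f g hf hg t x
    have h1 := hf t x
    have h2 := hg t x
    simp only [Points.value, map_add] at *
    rw [h1, h2, mul_add]
  smul_mem' := by
    intro c f hf t x
    have h1 := hf t x
    have hc : ∀ y : Points K A, y.evalHom (c • f) = c * y.evalHom f := fun y =>
      map_smul (show A →ₐ[K] K from y) c f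
    simp only [Points.value] at *
    rw [hc, hc, h1]
    ring

end GmAction

namespace GaAction

/-- The orbit of the point `x`. -/
def orbit (σ : GaAction K A) (x : Points K A) : Set (Points K A) := Set.range fun s => σ.act s x

/-- A `𝔾ₐ`-action is compatible with a `𝔾ₘ`-action if the image of `𝔾ₘ` normalizes the image of
`𝔾ₐ` and generic `𝔾ₐ`-orbits coincide with the closures of generic `𝔾ₘ`-orbits. -/
structure IsCompatible (σ : GaAction K A) (ρ : GmAction K A) : Prop where
  normalizes : ∀ t : Kˣ,
    σ.act.range.map (MulAut.conj (ρ.act t)).toMonoidHom = σ.act.range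
  orbit_eq : ∃ U : Set (Points K A), IsOpen U ∧ U.Nonempty ∧
    ∀ x ∈ U, σ.orbit x = closure (ρ.orbit x)

/-- The `𝔾ₐ`-action is `s ↦ exp(s δ)`, for a locally nilpotent derivation `δ`: the pullback of a
function `f` by `s` is `∑ n, (s ^ n / n!) δⁿ(f)`, a sum that may be cut off at any `N` with
`δ^N(f) = 0`. -/
def IsExpOf (σ : GaAction K A) (δ : Derivation K A A) : Prop :=
  ∀ (f : A) (N : ℕ), (⇑δ)^[N] f = 0 → ∀ (s : K) (x : Points K A),
    Points.value f (σ.act (Multiplicative.ofAdd s) x) =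
      ∑ n ∈ Finset.range N, s ^ n / (n.factorial : K) * Points.value ((⇑δ)^[n] f) x

end GaAction

namespace Derivation

/-- Every element is killed by some power of the derivation. -/
def IsLocallyNilpotent (δ : Derivation K A A) : Prop := ∀ f : A, ∃ N : ℕ, (⇑δ)^[N] f = 0

/-- The derivation is homogeneous, of some degree `d`, for the grading given by the action. -/
def IsHomogeneousFor (δ : Derivation K A A) (ρ : GmAction K A) : Prop :=
  ∃ d : ℤ, ∀ (i : ℤ), ∀ f ∈ ρ.weightSpace i, δ f ∈ ρ.weightSpace (i + d)

end Derivation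

/-- There is a prime divisor (an irreducible closed subset of codimension one) all of whose points
are fixed by the action. -/
def HasFixedPrimeDivisor (ρ : GmAction K A) : Prop :=
  ∃ D : TopologicalSpace.IrreducibleCloseds (Points K A), Order.coheight D = 1 ∧
    ∀ x ∈ D, ∀ t : Kˣ, ρ.act t x = x

end

/-! Suppose a prime divisor is fixed pointwise. Functions of nonzero weight vanish on it, so its
height-one prime `P` is homogeneous and contains every `A_i` with `i ≠ 0`. By normality `A_P` is a
discrete valuation ring, and some homogeneous generator of `P` is a uniformizer `u`, of weight `d`
say. Comparing components in `q f = p u^m` shows that each nonzero homogeneous `f` is `u^m`, `m ≥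
0`, times a fraction of invariants. All weights are thus multiples of `d`, and effectiveness forces
`d = ±1` (`exists_uniformizer`). Generically `X` is then a family of lines with coordinate `u`, on
which the torus acts by scaling. With `E` the Euler derivation and `h ≠ 0` a suitable invariant, `h
E` is divisible by `u` (`dvd_mul_euler`). The quotient `δ = h E / u` has kernel `A_0` and lowers the
exponent `m`, hence is locally nilpotent. Since `δ u = d h`, its exponential translates `u` along
each generic line, and the line is the closure of the torus orbit `u ≠ 0`
(`orbit_expAction_eq_closure`).

Conversely, suppose generic `𝔾ₐ`-orbits are the closures of `𝔾ₘ`-orbits. A function of nonzero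
weight restricts to a nonconstant polynomial in the `𝔾ₐ`-parameter on such an orbit, so it has a
zero there. This rules out weights of opposite sign, since a suitable product would be a nonzero
invariant with a zero on the orbit (`mul_pos_of_orbit_eq`). All functions of nonzero weight then
vanish at the same single parameter `r`, so each restricts to `c (s - r)^n`. As the leading
coefficients are invariant, any two of them are multiplicatively dependent over `A_0`
(`exists_mul_pow_eq_mul_pow`), and `A` is algebraic over `A_0[f]` for each homogeneous `f ≠ 0` of
nonzero weight. The span of the nonzero weight spaces is the kernel of a ring homomorphism onto
`A_0`, hence a prime. Algebraicity makes its height one (`height_ker_invariantPart`), and all its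
zeros are fixed points. -/

namespace Points

/-! ### Values of functions and the Zariski topology. -/

section Basic

variable {K A : Type*} [Field K] [CommRing A] [Algebra K A]

@[simp] theorem value_zero (x : Points K A) : value (0 : A) x = 0 := map_zero _
@[simp] theorem value_one (x : Points K A) : value (1 : A) x = 1 := map_one _
@[simp] theorem value_add (f g : A) (x : Points K A) : value (f + g) x = value f x + value g x :=
  map_add _ _ _
@[simp] theorem value_sub (f g : A) (x : Points K A) : value (f - g) x = value f x - value g x :=
  map_sub _ _ _
@[simp] theorem value_mul (f g : A) (x : Points K A) : value (f * g) x = value f x * value g x :=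
  map_mul _ _ _
@[simp] theorem value_pow (f : A) (n : ℕ) (x : Points K A) : value (f ^ n) x = value f x ^ n :=
  map_pow _ _ _
@[simp] theorem value_sum {ι : Type*} (s : Finset ι) (f : ι → A) (x : Points K A) :
    value (∑ i ∈ s, f i) x = ∑ i ∈ s, value (f i) x := map_sum _ _ _
@[simp] theorem value_algebraMap (c : K) (x : Points K A) : value (algebraMap K A c) x = c :=
  AlgHom.commutes (show A →ₐ[K] K from x) c
@[simp] theorem value_smul (c : K) (f : A) (x : Points K A) : value (c • f) x = c * value f x :=
  map_smul (show A →ₐ[K] K from x) c f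

@[ext] theorem ext {x y : Points K A} (h : ∀ f : A, value f x = value f y) : x = y :=
  AlgHom.ext (φ₁ := (show A →ₐ[K] K from x)) (φ₂ := (show A →ₐ[K] K from y)) h

/-- The point given by an algebra homomorphism. -/
def ofAlgHom (φ : A →ₐ[K] K) : Points K A := φ

@[simp] theorem value_ofAlgHom (φ : A →ₐ[K] K) (f : A) : value f (ofAlgHom φ) = φ f := rfl

theorem isClosed_zeroSet (S : Set A) : IsClosed {x : Points K A | ∀ f ∈ S, value f x = 0} :=
  (isClosed_iff_exists_zeroSet _).2 ⟨S, rfl⟩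

theorem isOpen_value_ne_zero (f : A) : IsOpen {x : Points K A | value f x ≠ 0} := by
  rw [← isClosed_compl_iff]
  convert isClosed_zeroSet (K := K) {f} using 1
  ext x
  simp

theorem exists_value_ne_zero_of_isOpen {U : Set (Points K A)} (hU : IsOpen U) {x : Points K A}
    (hx : x ∈ U) : ∃ g : A, value g x ≠ 0 ∧ ∀ y, value g y ≠ 0 → y ∈ U := by
  obtain ⟨S, hS⟩ := (isClosed_iff_exists_zeroSet _).1 hU.isClosed_compl
  have hx' : x ∉ {x : Points K A | ∀ f ∈ S, value f x = 0} := by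
    rw [← hS]; simpa using hx
  simp only [Set.mem_ofPred_eq, not_forall] at hx'
  obtain ⟨g, hg, hgx⟩ := hx'
  refine ⟨g, hgx, fun y hy => ?_⟩
  by_contra h
  have : y ∈ {x : Points K A | ∀ f ∈ S, value f x = 0} := by rw [← hS]; exact h
  exact hy (this g hg)

theorem mem_closure_iff_value {Z : Set (Points K A)} {y : Points K A} :
    y ∈ closure Z ↔ ∀ f : A, (∀ x ∈ Z, value f x = 0) → value f y = 0 := by
  constructor
  · intro hy f hf
    have := closure_minimal (t := {x : Points K A | ∀ g ∈ ({f} : Set A), value g x = 0})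
      (fun x hx => by simpa using hf x hx) (isClosed_zeroSet _) hy
    simpa using this
  · intro h
    obtain ⟨S, hS⟩ := (isClosed_iff_exists_zeroSet _).1 (isClosed_closure (s := Z))
    rw [hS]
    intro f hf
    refine h f fun x hx => ?_
    have : x ∈ closure Z := subset_closure hx
    rw [hS] at this
    exact this f hf

end Basic

/-! ### Nullstellensatz and density of open sets. -/

section Nullstellensatz

variable {K A : Type*} [Field K] [IsAlgClosed K] [CommRing A] [Algebra K A]
  [Algebra.FiniteType K A]

/-- As `A` is a Jacobson ring, `P` is an intersection of maximal ideals. Some maximal ideal above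
`P` avoids `f`, and its residue field is finite over `K`, hence equal to `K`. -/
theorem exists_forall_mem_value_eq_zero (P : Ideal A) [P.IsPrime] {f : A} (hf : f ∉ P) :
    ∃ x : Points K A, (∀ g ∈ P, value g x = 0) ∧ value f x ≠ 0 := by
  have : IsJacobsonRing A := isJacobsonRing_of_finiteType (A := K)
  have hP : P.jacobson = P := IsJacobsonRing.out this (Ideal.IsPrime.isRadical ‹_›)
  rw [← hP, Ideal.jacobson, Ideal.mem_sInf] at hf
  push Not at hf
  obtain ⟨M, ⟨hPM, hM⟩, hfM⟩ := hf
  let _ : Field (A ⧸ M) := Ideal.Quotient.field M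
  have : Module.Finite K (A ⧸ M) := finite_of_finite_type_of_isJacobsonRing K (A ⧸ M)
  have hbij : Function.Bijective (algebraMap K (A ⧸ M)) :=
    IsAlgClosed.algebraMap_bijective_of_isIntegral
  let e : K ≃ₐ[K] A ⧸ M := AlgEquiv.ofBijective (Algebra.ofId K (A ⧸ M)) hbij
  refine ⟨ofAlgHom ((e.symm : (A ⧸ M) →ₐ[K] K).comp (Ideal.Quotient.mkₐ K M)), ?_, ?_⟩
  · intro g hg
    simp [Ideal.Quotient.eq_zero_iff_mem.2 (hPM hg)]
  · simpa [Ideal.Quotient.eq_zero_iff_mem] using hfM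

variable [IsDomain A]

variable (K) in
theorem exists_value_ne_zero {f : A} (hf : f ≠ 0) : ∃ x : Points K A, value f x ≠ 0 := by
  obtain ⟨x, -, hx⟩ := exists_forall_mem_value_eq_zero (K := K) (⊥ : Ideal A) (f := f) (by simpa)
  exact ⟨x, hx⟩

theorem eq_of_value_eq {f g : A} (h : ∀ x : Points K A, value f x = value g x) : f = g := by
  by_contra hne
  obtain ⟨x, hx⟩ := exists_value_ne_zero K (sub_ne_zero.2 hne)
  exact hx (by simp [h])

theorem eq_of_value_eq_on_isOpen {U : Set (Points K A)} (hU : IsOpen U) (hne : U.Nonempty)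
    {f g : A} (h : ∀ x ∈ U, value f x = value g x) : f = g := by
  obtain ⟨x, hx⟩ := hne
  obtain ⟨a, ha, haU⟩ := exists_value_ne_zero_of_isOpen hU hx
  have ha0 : a ≠ 0 := by rintro rfl; simp at ha
  refine mul_left_cancel₀ ha0 (eq_of_value_eq (K := K) fun y => ?_)
  by_cases hy : value a y = 0
  · simp [hy]
  · simp [h y (haU y hy)]

theorem exists_mem_value_ne_zero {U : Set (Points K A)} (hU : IsOpen U) (hne : U.Nonempty)
    {f : A} (hf : f ≠ 0) : ∃ x ∈ U, value f x ≠ 0 := by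
  by_contra! h
  exact hf (eq_of_value_eq_on_isOpen hU hne fun x hx => by rw [h x hx, value_zero])

end Nullstellensatz

/-! ### Prime ideals and irreducible closed sets. -/

section PrimeCorrespondence

open TopologicalSpace

variable (K A : Type*) [Field K] [CommRing A] [Algebra K A]

variable {K A} in
/-- The ideal of the functions vanishing on a set of points. -/
def vanishingIdeal (Z : Set (Points K A)) : Ideal A where
  carrier := {f | ∀ x ∈ Z, value f x = 0}
  zero_mem' := by simp
  add_mem' := by
    intro f g hf hg x hx
    simp [hf x hx, hg x hx]
  smul_mem' := by
    intro c f hf x hx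
    simp [hf x hx]

variable {K A} in
theorem mem_vanishingIdeal {Z : Set (Points K A)} {f : A} :
    f ∈ vanishingIdeal Z ↔ ∀ x ∈ Z, value f x = 0 := Iff.rfl

variable {K A} in
theorem isPrime_vanishingIdeal {Z : Set (Points K A)} (hZ : IsIrreducible Z) :
    (vanishingIdeal Z).IsPrime := by
  refine ⟨fun h => ?_, fun {f g} hfg => ?_⟩
  · obtain ⟨x, hx⟩ := hZ.1
    have : (1 : A) ∈ vanishingIdeal Z := by rw [h]; trivial
    simpa using this x hx
  · by_contra! hcon
    simp only [mem_vanishingIdeal, not_forall] at hcon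
    obtain ⟨⟨x, hx, hfx⟩, y, hy, hgy⟩ := hcon
    obtain ⟨z, hz, hfz, hgz⟩ := hZ.2 _ _ (isOpen_value_ne_zero f) (isOpen_value_ne_zero g)
      ⟨x, hx, hfx⟩ ⟨y, hy, hgy⟩
    have := hfg z hz
    rw [value_mul] at this
    exact mul_ne_zero hfz hgz this

variable [IsAlgClosed K] [Algebra.FiniteType K A]

variable {K A} in
/-- The irreducible closed set of points defined by a prime ideal. -/
def zeroLocus (P : PrimeSpectrum A) : IrreducibleCloseds (Points K A) where
  carrier := {x | ∀ f ∈ P.asIdeal, value f x = 0}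
  isIrreducible' := by
    constructor
    · obtain ⟨x, hx, -⟩ := exists_forall_mem_value_eq_zero (K := K) P.asIdeal
        (f := 1) (fun h => P.isPrime.ne_top ((Ideal.eq_top_iff_one _).2 h))
      exact ⟨x, hx⟩
    · rintro U V hU hV ⟨x, hx, hxU⟩ ⟨y, hy, hyV⟩
      obtain ⟨a, ha, haU⟩ := exists_value_ne_zero_of_isOpen hU hxU
      obtain ⟨b, hb, hbV⟩ := exists_value_ne_zero_of_isOpen hV hyV
      have haP : a ∉ P.asIdeal := fun h => ha (hx a h)
      have hbP : b ∉ P.asIdeal := fun h => hb (hy b h)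
      obtain ⟨z, hz, hab⟩ := exists_forall_mem_value_eq_zero (K := K) P.asIdeal
        (f := a * b) (fun h => (P.isPrime.mem_or_mem h).elim haP hbP)
      rw [value_mul] at hab
      exact ⟨z, hz, haU z (left_ne_zero_of_mul hab), hbV z (right_ne_zero_of_mul hab)⟩
  isClosed' := isClosed_zeroSet _

variable {K A} in
theorem mem_zeroLocus {P : PrimeSpectrum A} {x : Points K A} :
    x ∈ zeroLocus P ↔ ∀ f ∈ P.asIdeal, value f x = 0 := Iff.rfl

/-- Prime ideals correspond to irreducible closed sets of points, with reversed inclusions. -/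
def primeSpectrumOrderIso : PrimeSpectrum A ≃o (IrreducibleCloseds (Points K A))ᵒᵈ where
  toFun P := OrderDual.toDual (zeroLocus P)
  invFun D := ⟨vanishingIdeal
      ((OrderDual.ofDual D : IrreducibleCloseds (Points K A)) : Set (Points K A)),
    isPrime_vanishingIdeal (OrderDual.ofDual D).isIrreducible⟩
  left_inv P := by
    ext f
    constructor
    · intro hf
      by_contra hfP
      obtain ⟨x, hx, hfx⟩ := exists_forall_mem_value_eq_zero (K := K) P.asIdeal hfP
      exact hfx (hf x hx)
    · exact fun hf x hx => hx f hf
  right_inv D := by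
    refine congrArg OrderDual.toDual (IrreducibleCloseds.ext (Set.ext fun x => ?_))
    have := mem_closure_iff_value (y := x)
      (Z := ((OrderDual.ofDual D : IrreducibleCloseds (Points K A)) : Set (Points K A)))
    rw [(OrderDual.ofDual D).isClosed.closure_eq] at this
    exact this.symm
  map_rel_iff' {P Q} := by
    constructor
    · intro h f hf
      by_contra hfQ
      obtain ⟨x, hx, hfx⟩ := exists_forall_mem_value_eq_zero (K := K) Q.asIdeal hfQ
      exact hfx (h hx f hf)
    · exact fun h x hx f hf => hx f (h hf)

variable {A} in
theorem coheight_zeroLocus (P : PrimeSpectrum A) :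
    Order.coheight (zeroLocus (K := K) P) = P.asIdeal.height := by
  rw [PrimeSpectrum.height_eq_orderHeight, ← Order.height_orderIso (primeSpectrumOrderIso K A)]
  rfl

end PrimeCorrespondence

end Points

/-! ### Laurent polynomials and independence of characters. -/

theorem LaurentPolynomial.eval₂_eq_sum {R S : Type*} [CommSemiring R] [CommSemiring S]
    (f : R →+* S) (t : Sˣ) (F : R[T;T⁻¹]) :
    LaurentPolynomial.eval₂ f t F =
      ∑ i ∈ F.coeff.support, f (F.coeff i) * ((t ^ i : Sˣ) : S) := by
  conv_lhs => rw [← AddMonoidAlgebra.sum_coeff_single F]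
  rw [Finsupp.sum, map_sum]
  refine Finset.sum_congr rfl fun i _ => ?_
  rw [LaurentPolynomial.single_eq_C_mul_T, LaurentPolynomial.eval₂_C_mul_T]

/-- The characters `t ↦ t ^ i` of the multiplicative group are linearly independent. -/
theorem linearIndependent_unit_zpow (K : Type*) [Field K] [CharZero K] :
    LinearIndependent K (fun (i : ℤ) (t : Kˣ) => ((t ^ i : Kˣ) : K)) := by
  have h := (linearIndependent_monoidHom Kˣ K).comp
    (fun i : ℤ => (Units.coeHom K).comp (zpowGroupHom i : Kˣ →* Kˣ)) (by
      intro i j hij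
      -- The value at `2` separates the characters. The equality is moved to `ℚ`, where injectivity
      -- of `i ↦ 2 ^ i` follows from the order.
      have h2 := DFunLike.congr_fun hij (Units.mk0 (2 : K) two_ne_zero)
      simp only [MonoidHom.comp_apply, zpowGroupHom_apply, Units.coeHom_apply,
        Units.val_zpow_eq_zpow_val, Units.val_mk0] at h2
      have h3 : ((2 : ℚ) ^ i) = 2 ^ j :=
        Rat.cast_injective (α := K) (by push_cast; exact h2)
      exact zpow_right_injective₀ (by norm_num) (by norm_num) h3)
  exact h

theorem LaurentPolynomial.map_coeff_eq_zero_of_eval₂_eq_zero {R K : Type*} [CommSemiring R]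
    [Field K] [CharZero K] (f : R →+* K) {F : R[T;T⁻¹]}
    (h : ∀ t : Kˣ, LaurentPolynomial.eval₂ f t F = 0) (i : ℤ) : f (F.coeff i) = 0 := by
  by_cases hi : i ∈ F.coeff.support
  · refine linearIndependent_iff'.1 (linearIndependent_unit_zpow K) F.coeff.support
      (fun i => f (F.coeff i)) ?_ i hi
    ext t
    simpa [LaurentPolynomial.eval₂_eq_sum] using h t
  · simp [Finsupp.notMem_support_iff.1 hi]

/-! ### The weight grading of a torus action. -/

namespace GmAction

open LaurentPolynomial Points

variable {K A : Type*} [Field K] [CommRing A] [Algebra K A]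

section Basic

variable {ρ : GmAction K A}

theorem value_act_of_mem_zero {f : A} (hf : f ∈ ρ.weightSpace 0) (t : Kˣ) (x : Points K A) :
    value f (ρ.act t x) = value f x := by
  simpa using hf t x

theorem algebraMap_mem_weightSpace (c : K) : algebraMap K A c ∈ ρ.weightSpace 0 := by
  intro t x
  simp

theorem one_mem_weightSpace : (1 : A) ∈ ρ.weightSpace 0 := by
  intro t x
  simp

theorem mul_mem_weightSpace {i j : ℤ} {f g : A} (hf : f ∈ ρ.weightSpace i)
    (hg : g ∈ ρ.weightSpace j) : f * g ∈ ρ.weightSpace (i + j) := by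
  intro t x
  rw [value_mul, value_mul, hf t x, hg t x, zpow_add, Units.val_mul]
  ring

theorem pow_mem_weightSpace {i : ℤ} {f : A} (hf : f ∈ ρ.weightSpace i) (n : ℕ) :
    f ^ n ∈ ρ.weightSpace (n * i) := by
  induction n with
  | zero => simpa using one_mem_weightSpace
  | succ n ih =>
    rw [pow_succ]
    convert mul_mem_weightSpace ih hf using 2
    push_cast
    ring

theorem mul_mem_weightSpace_left {i : ℤ} {f g : A} (hf : f ∈ ρ.weightSpace 0)
    (hg : g ∈ ρ.weightSpace i) : f * g ∈ ρ.weightSpace i := by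
  simpa using mul_mem_weightSpace hf hg

variable (ρ) in
/-- The algebra of invariant functions. -/
def invariants : Subalgebra K A where
  carrier := {f | f ∈ ρ.weightSpace 0}
  mul_mem' hf hg := mul_mem_weightSpace_left hf hg
  add_mem' hf hg := (ρ.weightSpace 0).add_mem hf hg
  algebraMap_mem' c := algebraMap_mem_weightSpace c

/-- A homogeneous function vanishing at one point of an orbit vanishes on the whole orbit, hence on
its closure. This transports homogeneous relations from `x` to limit points. -/
theorem value_eq_zero_of_mem_closure_orbit {i : ℤ} {f : A} (hf : f ∈ ρ.weightSpace i)
    {x y : Points K A} (hx : value f x = 0) (hy : y ∈ closure (ρ.orbit x)) : value f y = 0 := by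
  refine mem_closure_iff_value.1 hy f ?_
  rintro _ ⟨t, rfl⟩
  rw [hf t x, hx, mul_zero]

theorem value_eq_of_mem_closure_orbit {f : A} (hf : f ∈ ρ.weightSpace 0)
    {x y : Points K A} (hy : y ∈ closure (ρ.orbit x)) : value f y = value f x := by
  have h := value_eq_zero_of_mem_closure_orbit
    (sub_mem hf (algebraMap_mem_weightSpace (value f x))) (x := x) (by simp) hy
  simpa [sub_eq_zero] using h

end Basic

section Coaction

variable [IsAlgClosed K] [CharZero K] [IsDomain A] [Algebra.FiniteType K A]

/-- This uniqueness makes the chosen pullbacks of an action depend on `f` as a ring homomorphism. -/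
theorem eq_of_forall_eval₂_eq {F G : A[T;T⁻¹]}
    (h : ∀ (t : Kˣ) (x : Points K A), eval₂ x.evalHom t F = eval₂ x.evalHom t G) : F = G := by
  rw [← sub_eq_zero]
  ext i
  refine eq_of_value_eq (K := K) fun x => ?_
  exact (map_coeff_eq_zero_of_eval₂_eq_zero x.evalHom (F := F - G)
    (fun t => by rw [map_sub, h t x, sub_self]) i).trans (value_zero x).symm

variable (ρ : GmAction K A)

/-- The pullback of functions along the action map `𝔾ₘ × X → X`. -/
noncomputable def coact : A →+* A[T;T⁻¹] where
  toFun f := (ρ.regular f).choose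
  map_one' := eq_of_forall_eval₂_eq (K := K) fun t x => by
    rw [← (ρ.regular 1).choose_spec t x]; simp
  map_zero' := eq_of_forall_eval₂_eq (K := K) fun t x => by
    rw [← (ρ.regular 0).choose_spec t x]; simp
  map_mul' f g := eq_of_forall_eval₂_eq (K := K) fun t x => by
    rw [← (ρ.regular (f * g)).choose_spec t x, map_mul, ← (ρ.regular f).choose_spec t x,
      ← (ρ.regular g).choose_spec t x, value_mul]
  map_add' f g := eq_of_forall_eval₂_eq (K := K) fun t x => by
    rw [← (ρ.regular (f + g)).choose_spec t x, map_add, ← (ρ.regular f).choose_spec t x,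
      ← (ρ.regular g).choose_spec t x, value_add]

theorem value_act (f : A) (t : Kˣ) (x : Points K A) :
    value f (ρ.act t x) = eval₂ x.evalHom t (ρ.coact f) :=
  (ρ.regular f).choose_spec t x

/-- The component of weight `i` of a function. -/
noncomputable def component (i : ℤ) (f : A) : A := (ρ.coact f).coeff i

theorem component_add (i : ℤ) (f g : A) :
    ρ.component i (f + g) = ρ.component i f + ρ.component i g := by
  simp [component]

theorem value_act_eq_sum (f : A) (t : Kˣ) (x : Points K A) :
    value f (ρ.act t x) = ∑ i ∈ (ρ.coact f).coeff.support,
      value (ρ.component i f) x * ((t ^ i : Kˣ) : K) := by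
  rw [value_act, eval₂_eq_sum]
  rfl

theorem sum_component (f : A) :
    ∑ i ∈ (ρ.coact f).coeff.support, ρ.component i f = f := by
  refine eq_of_value_eq (K := K) fun x => ?_
  have := ρ.value_act_eq_sum f 1 x
  simpa using this.symm

/-- Expand `f((s t) • x) = f(s • (t • x))` in powers of `s` in both ways; independence of characters
allows comparing coefficients. -/
theorem component_mem (i : ℤ) (f : A) : ρ.component i f ∈ ρ.weightSpace i := by
  intro t x
  by_cases hi : i ∈ (ρ.coact f).coeff.support
  · have := linearIndependent_iff'.1 (linearIndependent_unit_zpow K) (ρ.coact f).coeff.support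
      (fun i => value (ρ.component i f) (ρ.act t x) -
        ((t ^ i : Kˣ) : K) * value (ρ.component i f) x) ?_ i hi
    · exact sub_eq_zero.1 this
    · ext s
      have h1 := ρ.value_act_eq_sum f s (ρ.act t x)
      have h2 := ρ.value_act_eq_sum f (s * t) x
      rw [map_mul, Equiv.Perm.mul_apply, h1] at h2
      simp only [Finset.sum_apply, Pi.smul_apply, smul_eq_mul, Pi.zero_apply, sub_mul,
        Finset.sum_sub_distrib]
      rw [h2, sub_eq_zero]
      refine Finset.sum_congr rfl fun j _ => ?_
      rw [mul_zpow, Units.val_mul]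
      ring
  · have : ρ.component i f = 0 := Finsupp.notMem_support_iff.1 hi
    simp [this]

variable {ρ}

theorem coact_of_mem {i : ℤ} {f : A} (hf : f ∈ ρ.weightSpace i) : ρ.coact f = .single i f :=
  eq_of_forall_eval₂_eq (K := K) fun t x => by
    rw [← value_act, hf t x, single_eq_C_mul_T, eval₂_C_mul_T, mul_comm]
    rfl

theorem component_of_mem {i : ℤ} {f : A} (hf : f ∈ ρ.weightSpace i) : ρ.component i f = f := by
  rw [component, coact_of_mem hf, AddMonoidAlgebra.coeff_single, Finsupp.single_eq_same]

theorem component_of_mem_of_ne {i j : ℤ} {f : A} (hf : f ∈ ρ.weightSpace i) (hij : j ≠ i) :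
    ρ.component j f = 0 := by
  rw [component, coact_of_mem hf, AddMonoidAlgebra.coeff_single, Finsupp.single_eq_of_ne hij]

theorem component_mul_of_mem {i : ℤ} {f : A} (hf : f ∈ ρ.weightSpace i) (j : ℤ) (g : A) :
    ρ.component j (g * f) = ρ.component (j - i) g * f := by
  rw [component, map_mul, coact_of_mem hf, AddMonoidAlgebra.coeff_mul_single_apply,
    ← sub_eq_add_neg]
  rfl

theorem weightSpace_induction (ρ : GmAction K A) {p : A → Prop}
    (mem : ∀ (i : ℤ) (f : A), f ∈ ρ.weightSpace i → p f)
    (add : ∀ f g, p f → p g → p (f + g)) (f : A) : p f := by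
  rw [← ρ.sum_component f]
  exact Finset.sum_induction _ p add (mem 0 0 (zero_mem _)) fun i _ => mem i _ (ρ.component_mem i f)

theorem eq_of_mem_of_mem {i j : ℤ} {f : A} (hf : f ≠ 0) (hi : f ∈ ρ.weightSpace i)
    (hj : f ∈ ρ.weightSpace j) : i = j := by
  by_contra hij
  exact hf ((component_of_mem hi).symm.trans (component_of_mem_of_ne hj hij))

/-- A function is of weight `i` as soon as its product with a nonzero homogeneous function
has the appropriate weight. -/
theorem mem_weightSpace_of_mul_mem {i j : ℤ} {f u : A} (hu0 : u ≠ 0) (hu : u ∈ ρ.weightSpace j)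
    (hfu : f * u ∈ ρ.weightSpace (i + j)) : f ∈ ρ.weightSpace i := by
  have h := component_mul_of_mem hu (i + j) f
  rw [component_of_mem hfu, add_sub_cancel_right] at h
  rw [mul_right_cancel₀ hu0 h]
  exact ρ.component_mem i f

theorem act_eq_self_of_forall {x : Points K A} {t : Kˣ}
    (h : ∀ (i : ℤ) (f : A), f ∈ ρ.weightSpace i → value f (ρ.act t x) = value f x) :
    ρ.act t x = x :=
  Points.ext (weightSpace_induction ρ h fun f g hf hg => by simp [hf, hg])

/-- If all weights of an effective action are multiples of `d`, then `d = ±1`. -/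
theorem IsEffective.isUnit_of_forall_dvd (hρ : ρ.IsEffective) {d : ℤ}
    (h : ∀ (i : ℤ) (f : A), f ∈ ρ.weightSpace i → f ≠ 0 → d ∣ i) : IsUnit d := by
  by_contra hd
  -- Such a `ζ` acts trivially on every weight space, against effectiveness. It is a primitive root
  -- of unity of order `|d|`, or `-1` when `d = 0`.
  obtain ⟨ζ, hζ1, hζ⟩ : ∃ ζ : Kˣ, ζ ≠ 1 ∧ ζ ^ d = 1 := by
    obtain rfl | h0 := eq_or_ne d 0
    · refine ⟨-1, fun h1 => ?_, zpow_zero _⟩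
      have := congrArg Units.val h1
      norm_num at this
    · have hn : d.natAbs ≠ 0 := by simpa using h0
      have : NeZero (d.natAbs : K) := ⟨by exact_mod_cast hn⟩
      have : NeZero d.natAbs := ⟨hn⟩
      obtain ⟨z, hz⟩ := HasEnoughRootsOfUnity.exists_primitiveRoot K d.natAbs
      have hz1 : z ≠ 1 := by
        rintro rfl
        have := hz.eq_orderOf
        rw [orderOf_one] at this
        exact hd (Int.isUnit_iff_natAbs_eq.2 this)
      have hpow : (hz.isUnit hn).unit ^ d.natAbs = 1 := by
        ext
        simpa using hz.pow_eq_one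
      refine ⟨(hz.isUnit hn).unit, fun h1 => hz1 ?_, ?_⟩
      · simpa using congrArg Units.val h1
      · generalize (hz.isUnit hn).unit = w at hpow
        obtain ⟨k, hk⟩ : (d.natAbs : ℤ) ∣ d := Int.natAbs_dvd.2 dvd_rfl
        rw [hk, zpow_mul, zpow_natCast, hpow, one_zpow]
  refine hζ1 (hρ (?_ : ρ.act ζ = ρ.act 1))
  ext1 x
  rw [map_one, Equiv.Perm.one_apply]
  refine act_eq_self_of_forall fun i f hf => ?_
  obtain rfl | hf0 := eq_or_ne f 0
  · simp
  · obtain ⟨k, rfl⟩ := h i f hf hf0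
    rw [hf ζ x, zpow_mul, hζ, one_zpow, Units.val_one, one_mul]

theorem IsEffective.exists_mem_weightSpace (hρ : ρ.IsEffective) :
    ∃ (i : ℤ) (f : A), i ≠ 0 ∧ f ∈ ρ.weightSpace i ∧ f ≠ 0 := by
  by_contra! h
  refine not_isUnit_zero (hρ.isUnit_of_forall_dvd (d := 0) fun i f hf hf0 => ?_)
  by_contra hi
  exact hf0 (h i f (fun h0 => hi (h0 ▸ dvd_rfl)) hf)

end Coaction

end GmAction

/-! ### Height-one primes and homogeneous uniformizers. -/

/-- A noetherian normal domain is regular in codimension one. -/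
theorem isDiscreteValuationRing_of_height_eq_one {A : Type*} [CommRing A] [IsDomain A]
    [IsNoetherianRing A] [IsIntegrallyClosed A] (I : Ideal A) [I.IsPrime] (hI : I.height = 1) :
    IsDiscreteValuationRing (Localization.AtPrime I) := by
  have hclosed : IsIntegrallyClosed (Localization.AtPrime I) :=
    isIntegrallyClosed_of_isLocalization (Localization.AtPrime I) I.primeCompl
      I.primeCompl_le_nonZeroDivisors
  have hnoeth : IsNoetherianRing (Localization.AtPrime I) :=
    IsLocalization.isNoetherianRing I.primeCompl _ inferInstance
  have hm : (IsLocalRing.maximalIdeal (Localization.AtPrime I)).height = 1 := by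
    rw [← IsLocalization.height_under I.primeCompl, IsLocalization.AtPrime.under_maximalIdeal _ I,
      hI]
  have hpir : IsPrincipalIdealRing (Localization.AtPrime I) := by
    have htfae := (tfae_of_isNoetherianRing_of_isLocalRing_of_isDomain
      (Localization.AtPrime I)).out 3 0
    refine htfae.1 ⟨hclosed, fun P hP hPprime => ?_⟩
    by_contra hne
    -- A prime strictly below a maximal ideal of height one has height zero, so it is zero.
    have hlt : P < IsLocalRing.maximalIdeal (Localization.AtPrime I) :=
      lt_of_le_of_ne (IsLocalRing.le_maximalIdeal hPprime.ne_top) hne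
    have := (Ideal.height_le_iff (n := 1)).1 (by rw [hm]; rfl) P hPprime hlt
    exact hP (Ideal.height_eq_zero_iff_eq_bot.1 (by simpa using this))
  exact { hpir with not_a_field' := Ideal.ne_bot_of_height_eq_one hm }

/-- Among generators of a height one prime ideal of a noetherian normal domain there is a
uniformizer of the local ring. -/
theorem exists_uniformizer_of_span_eq {A : Type*} [CommRing A] [IsDomain A]
    [IsNoetherianRing A] [IsIntegrallyClosed A] (I : Ideal A) [I.IsPrime] (hI : I.height = 1)
    {S : Set A} (hS : Ideal.span S = I) :
    ∃ u ∈ S, u ≠ 0 ∧ ∀ f : A, f ≠ 0 → ∃ (m : ℕ) (p q : A), p ∉ I ∧ q ∉ I ∧ q * f = p * u ^ m := by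
  have := isDiscreteValuationRing_of_height_eq_one I hI
  set O := Localization.AtPrime I
  have hinj : Function.Injective (algebraMap A O) := FaithfulSMul.algebraMap_injective A O
  obtain ⟨ϖ, hϖ⟩ := IsDiscreteValuationRing.exists_irreducible O
  have hspan : Ideal.span (algebraMap A O '' S) = IsLocalRing.maximalIdeal O := by
    rw [← Ideal.map_span, hS]
    exact IsLocalization.AtPrime.map_eq_maximalIdeal I O
  -- If `ϖ ^ 2` divided all generators it would divide `ϖ`. So some generator has valuation exactly
  -- one.
  obtain ⟨u, huS, hu⟩ : ∃ u ∈ S, ¬ ϖ ^ 2 ∣ algebraMap A O u := by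
    by_contra! h
    have hle : IsLocalRing.maximalIdeal O ≤ Ideal.span {ϖ ^ 2} := by
      rw [← hspan, Ideal.span_le]
      rintro _ ⟨s, hs, rfl⟩
      exact Ideal.mem_span_singleton.2 (h s hs)
    have h1 : ϖ ∈ Ideal.span {ϖ ^ 2} := hle (by
      rw [hϖ.maximalIdeal_eq]; exact Ideal.mem_span_singleton_self ϖ)
    obtain ⟨c, hc⟩ := Ideal.mem_span_singleton.1 h1
    refine hϖ.not_isUnit (IsUnit.of_mul_eq_one c (mul_left_cancel₀ hϖ.ne_zero ?_))
    rw [mul_one, ← mul_assoc, ← sq, ← hc]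
  have hu0 : algebraMap A O u ≠ 0 := fun h => hu (h ▸ dvd_zero _)
  have hirr : Irreducible (algebraMap A O u) := by
    obtain ⟨n, ε, hε⟩ := IsDiscreteValuationRing.eq_unit_mul_pow_irreducible hu0 hϖ
    have hmem : algebraMap A O u ∈ IsLocalRing.maximalIdeal O := by
      rw [← hspan]; exact Ideal.subset_span ⟨u, huS, rfl⟩
    have hn0 : n ≠ 0 := by
      rintro rfl
      rw [pow_zero, mul_one] at hε
      exact (IsLocalRing.mem_maximalIdeal _).1 hmem (hε ▸ ε.isUnit)
    have hn2 : ¬ 2 ≤ n := fun h2 => hu (by rw [hε]; exact (pow_dvd_pow ϖ h2).mul_left _)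
    obtain rfl : n = 1 := by omega
    rw [hε, pow_one]
    exact (irreducible_units_mul ε).2 hϖ
  refine ⟨u, huS, fun h => hu0 (by rw [h, map_zero]), fun f hf => ?_⟩
  obtain ⟨m, ε, hε⟩ := IsDiscreteValuationRing.eq_unit_mul_pow_irreducible
    (x := algebraMap A O f) (fun h => hf (hinj (by rw [h, map_zero]))) hirr
  obtain ⟨p, q, hpq⟩ := IsLocalization.exists_mk'_eq I.primeCompl (ε : O)
  have hp : p ∈ I.primeCompl :=
    (IsLocalization.AtPrime.isUnit_mk'_iff O I p q).1 (hpq ▸ ε.isUnit)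
  refine ⟨m, p, q, hp, q.2, hinj ?_⟩
  have hspec := IsLocalization.mk'_spec O p q
  rw [hpq] at hspec
  rw [map_mul, map_mul, map_pow, hε, ← hspec]
  ring

namespace GmAction

open LaurentPolynomial Points

variable {K A : Type*} [Field K] [CommRing A] [Algebra K A] [IsAlgClosed K] [CharZero K]
  [IsDomain A] [Algebra.FiniteType K A] {ρ : GmAction K A}

theorem mem_of_forall_component_mem {I : Ideal A} {f : A} (h : ∀ i, ρ.component i f ∈ I) :
    f ∈ I := by
  rw [← ρ.sum_component f]
  exact sum_mem fun i _ => h i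

/-- An ideal containing all functions of nonzero weight is homogeneous. -/
theorem component_mem_of_forall_mem {I : Ideal A}
    (hI : ∀ (i : ℤ) (f : A), i ≠ 0 → f ∈ ρ.weightSpace i → f ∈ I) {f : A} (hf : f ∈ I) (i : ℤ) :
    ρ.component i f ∈ I := by
  obtain rfl | hi := eq_or_ne i 0
  · by_cases h0 : (0 : ℤ) ∈ (ρ.coact f).coeff.support
    · have hsum := ρ.sum_component f
      rw [← Finset.add_sum_erase _ _ h0] at hsum
      rw [eq_sub_of_add_eq hsum]
      refine sub_mem hf (sum_mem fun i hi => ?_)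
      exact hI i _ (Finset.ne_of_mem_erase hi) (ρ.component_mem i f)
    · rw [show ρ.component 0 f = 0 from Finsupp.notMem_support_iff.1 h0]
      exact zero_mem _
  · exact hI i _ hi (ρ.component_mem i f)

theorem component_zero_notMem_of_forall_mem {I : Ideal A}
    (hI : ∀ (i : ℤ) (f : A), i ≠ 0 → f ∈ ρ.weightSpace i → f ∈ I) {f : A} (hf : f ∉ I) :
    ρ.component 0 f ∉ I := by
  intro h0
  refine hf (mem_of_forall_component_mem (ρ := ρ) fun i => ?_)
  obtain rfl | hi := eq_or_ne i 0
  · exact h0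
  · exact hI i _ hi (ρ.component_mem i f)

/-- Structure of the algebra of functions in presence of a divisor of fixed points: up to
invariant factors, homogeneous functions are the powers of a function of weight `±1`. -/
theorem exists_uniformizer [IsIntegrallyClosed A] (hρ : ρ.IsEffective) (I : Ideal A) [I.IsPrime]
    (hheight : I.height = 1)
    (hI : ∀ (i : ℤ) (f : A), i ≠ 0 → f ∈ ρ.weightSpace i → f ∈ I) :
    ∃ (d : ℤ) (u : A), IsUnit d ∧ u ≠ 0 ∧ u ∈ ρ.weightSpace d ∧
      ∀ (i : ℤ) (f : A), f ∈ ρ.weightSpace i → f ≠ 0 → ∃ (m : ℕ) (p q : A),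
        i = m * d ∧ p ∈ ρ.weightSpace 0 ∧ q ∈ ρ.weightSpace 0 ∧ q ≠ 0 ∧ q * f = p * u ^ m := by
  have : IsNoetherianRing A := Algebra.FiniteType.isNoetherianRing K A
  have hspan : Ideal.span {f | f ∈ I ∧ ∃ i, f ∈ ρ.weightSpace i} = I := by
    refine le_antisymm (Ideal.span_le.2 fun f hf => hf.1) fun f hf => ?_
    exact mem_of_forall_component_mem (ρ := ρ) fun i => Ideal.subset_span
      ⟨component_mem_of_forall_mem hI hf i, i, ρ.component_mem i f⟩
  obtain ⟨u, ⟨-, d, hud⟩, hu0, hu⟩ := exists_uniformizer_of_span_eq I hheight hspan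
  have key : ∀ (i : ℤ) (f : A), f ∈ ρ.weightSpace i → f ≠ 0 → ∃ (m : ℕ) (p q : A),
      i = m * d ∧ p ∈ ρ.weightSpace 0 ∧ q ∈ ρ.weightSpace 0 ∧ q ≠ 0 ∧ q * f = p * u ^ m := by
    intro i f hf hf0
    obtain ⟨m, p, q, hp, hq, hqf⟩ := hu f hf0
    have hum := pow_mem_weightSpace hud m
    -- In weight `i` the relation keeps only the invariant part of `q` and the part of `p` of weight
    -- `i - m * d`.
    have hcomp := congrArg (ρ.component i) hqf
    rw [component_mul_of_mem hf, component_mul_of_mem hum, sub_self] at hcomp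
    have hq0 := component_zero_notMem_of_forall_mem hI hq
    -- Otherwise that part of `p` lies in `I`. Eliminating `f` and cancelling `u ^ m` puts `q₀ * p`
    -- in `I`, although neither factor is there.
    have him : i = m * d := by
      by_contra hne
      have hpI := hI _ _ (sub_ne_zero.2 hne) (ρ.component_mem (i - m * d) p)
      refine hq0 ((Ideal.IsPrime.mem_or_mem ‹I.IsPrime› (x := ρ.component 0 q) (y := p)
        ?_).resolve_right hp)
      have h2 : ρ.component 0 q * p * u ^ m = q * ρ.component (i - m * d) p * u ^ m := by
        linear_combination q * hcomp - ρ.component 0 q * hqf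
      rw [mul_right_cancel₀ (pow_ne_zero m hu0) h2]
      exact Ideal.mul_mem_left _ _ hpI
    rw [him, sub_self] at hcomp
    exact ⟨m, _, _, him, ρ.component_mem 0 p, ρ.component_mem 0 q,
      fun h => hq0 (h ▸ zero_mem _), hcomp⟩
  refine ⟨d, u, hρ.isUnit_of_forall_dvd fun i f hf hf0 => ?_, hu0, hud, key⟩
  obtain ⟨m, p, q, rfl, -⟩ := key i f hf hf0
  exact dvd_mul_left _ _

end GmAction

/-! ### Exponentials of locally nilpotent derivations. -/

theorem Derivation.iterate_apply_mul {R A : Type*} [CommRing R] [CommRing A] [Algebra R A]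
    (δ : Derivation R A A) (n : ℕ) (f g : A) :
    (⇑δ)^[n] (f * g) =
      ∑ ij ∈ Finset.HasAntidiagonal.antidiagonal n,
        n.choose ij.1 • ((⇑δ)^[ij.1] f * (⇑δ)^[ij.2] g) := by
  induction n with
  | zero => simp
  | succ n ih =>
    rw [Finset.sum_antidiagonal_choose_succ_nsmul
      (M := A) (fun i j => (⇑δ)^[i] f * (⇑δ)^[j] g) n]
    simp only [Function.iterate_succ_apply', ih, map_sum, map_nsmul, Derivation.leibniz, nsmul_add,
      smul_eq_mul, Finset.sum_add_distrib]
    congr 1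
    refine Finset.sum_congr rfl fun ij hij => ?_
    rw [mul_comm ((⇑δ)^[ij.2] g),
      Nat.choose_symm_of_eq_add (Finset.HasAntidiagonal.mem_antidiagonal.1 hij).symm]

theorem Function.iterate_eq_zero_of_le {A : Type*} [Zero A] {δ : A → A} (h0 : δ 0 = 0) {f : A}
    {m n : ℕ} (hmn : m ≤ n) (h : δ^[m] f = 0) : δ^[n] f = 0 := by
  obtain ⟨k, rfl⟩ := Nat.exists_eq_add_of_le' hmn
  rw [Function.iterate_add_apply, h]
  exact Function.iterate_fixed h0 k

namespace Derivation.IsLocallyNilpotent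

open Points

variable {K A : Type*} [Field K] [CommRing A] [Algebra K A] {δ : Derivation K A A}

/-- The polynomial `exp(X δ)(f)`. -/
noncomputable def expPoly (hδ : δ.IsLocallyNilpotent) (f : A) : A[X] :=
  ∑ n ∈ Finset.range (hδ f).choose,
    Polynomial.monomial n ((n.factorial : K)⁻¹ • (⇑δ)^[n] f)

theorem coeff_expPoly (hδ : δ.IsLocallyNilpotent) (f : A) (n : ℕ) :
    (hδ.expPoly f).coeff n = (n.factorial : K)⁻¹ • (⇑δ)^[n] f := by
  simp only [expPoly, Polynomial.finsetSum_coeff, Polynomial.coeff_monomial,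
    Finset.sum_ite_eq', Finset.mem_range]
  split_ifs with h
  · rfl
  · rw [Function.iterate_eq_zero_of_le (map_zero δ) (not_lt.1 h) (hδ f).choose_spec, smul_zero]

theorem expPoly_eq_sum (hδ : δ.IsLocallyNilpotent) {f : A} {N : ℕ} (hN : (⇑δ)^[N] f = 0) :
    hδ.expPoly f =
      ∑ n ∈ Finset.range N, Polynomial.monomial n ((n.factorial : K)⁻¹ • (⇑δ)^[n] f) := by
  ext n
  rw [coeff_expPoly]
  simp only [Polynomial.finsetSum_coeff, Polynomial.coeff_monomial,
    Finset.sum_ite_eq', Finset.mem_range]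
  split_ifs with h
  · rfl
  · rw [Function.iterate_eq_zero_of_le (map_zero δ) (not_lt.1 h) hN, smul_zero]

variable [CharZero K]

/-- The exponential of a locally nilpotent derivation. -/
noncomputable def expHom (hδ : δ.IsLocallyNilpotent) : A →+* A[X] where
  toFun := hδ.expPoly
  map_zero' := by
    ext n
    simp [coeff_expPoly, Function.iterate_fixed]
  map_one' := by
    rw [hδ.expPoly_eq_sum (f := 1) (N := 1) (by simp)]
    simp
  map_add' f g := by
    ext n
    rw [Polynomial.coeff_add, coeff_expPoly, coeff_expPoly, coeff_expPoly, iterate_map_add,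
      smul_add]
  map_mul' f g := by
    ext n
    rw [Polynomial.coeff_mul, coeff_expPoly, Derivation.iterate_apply_mul, Finset.smul_sum]
    refine Finset.sum_congr rfl fun ij hij => ?_
    rw [Finset.HasAntidiagonal.mem_antidiagonal] at hij
    rw [coeff_expPoly, coeff_expPoly, smul_mul_smul_comm, ← Nat.cast_smul_eq_nsmul K, smul_smul,
      ← hij, Nat.cast_add_choose]
    congr 1
    have h1 : ((ij.1 + ij.2).factorial : K) ≠ 0 := by exact_mod_cast Nat.factorial_ne_zero _
    field_simp

/-- The point `exp(s δ) x`. -/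
noncomputable def expPoint (hδ : δ.IsLocallyNilpotent) (s : K) (x : Points K A) : Points K A :=
  ofAlgHom { (Polynomial.eval₂RingHom x.evalHom s).comp hδ.expHom with
    commutes' := fun c => by
      have h : hδ.expPoly (algebraMap K A c) = Polynomial.C (algebraMap K A c) := by
        rw [hδ.expPoly_eq_sum (N := 1) (by simp)]
        simp
      simp only [RingHom.toMonoidHom_eq_coe, OneHom.toFun_eq_coe, MonoidHom.toOneHom_coe,
        MonoidHom.coe_coe, RingHom.comp_apply]
      refine (congrArg _ h).trans ?_
      rw [Polynomial.coe_eval₂RingHom, Polynomial.eval₂_C]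
      exact value_algebraMap c x }

theorem value_expPoint_eq_eval₂ (hδ : δ.IsLocallyNilpotent) (s : K) (x : Points K A) (f : A) :
    value f (hδ.expPoint s x) = Polynomial.eval₂ x.evalHom s (hδ.expPoly f) := rfl

theorem value_expPoint (hδ : δ.IsLocallyNilpotent) {f : A} {N : ℕ} (hN : (⇑δ)^[N] f = 0) (s : K)
    (x : Points K A) :
    value f (hδ.expPoint s x) =
      ∑ n ∈ Finset.range N, s ^ n / (n.factorial : K) * value ((⇑δ)^[n] f) x := by
  rw [value_expPoint_eq_eval₂, hδ.expPoly_eq_sum hN, Polynomial.eval₂_finsetSum]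
  refine Finset.sum_congr rfl fun n _ => ?_
  rw [Polynomial.eval₂_monomial]
  refine (congrArg (· * s ^ n) (value_smul _ _ _)).trans ?_
  field_simp

theorem expPoint_zero (hδ : δ.IsLocallyNilpotent) (x : Points K A) : hδ.expPoint 0 x = x := by
  ext f
  rw [value_expPoint_eq_eval₂, Polynomial.eval₂_at_zero, coeff_expPoly]
  simp [value]

theorem expPoint_add (hδ : δ.IsLocallyNilpotent) (s t : K) (x : Points K A) :
    hδ.expPoint (s + t) x = hδ.expPoint s (hδ.expPoint t x) := by
  ext f
  obtain ⟨N, hN⟩ := hδ f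
  have hN' : ∀ n, (⇑δ)^[N] ((⇑δ)^[n] f) = 0 := fun n => by
    rw [← Function.iterate_add_apply]
    exact Function.iterate_eq_zero_of_le (map_zero δ) (Nat.le_add_right N n) hN
  rw [hδ.value_expPoint hN, hδ.value_expPoint hN]
  simp only [fun n => hδ.value_expPoint (hN' n) t x, Finset.mul_sum]
  -- Terms with `i + j ≥ N` vanish because `δ^N f = 0`; the rest are grouped along antidiagonals,
  -- each giving a binomial expansion.
  rw [← Finset.sum_product', ← Finset.sum_filter_of_ne (p := fun ij : ℕ × ℕ => ij.1 + ij.2 < N),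
    ← Finset.sum_fiberwise_of_maps_to (t := Finset.range N) (g := fun ij : ℕ × ℕ => ij.1 + ij.2)]
  · refine Finset.sum_congr rfl fun k hk => ?_
    rw [Finset.mem_range] at hk
    have hset : ((Finset.range N ×ˢ Finset.range N).filter
        (fun ij : ℕ × ℕ => ij.1 + ij.2 < N)).filter (fun ij => ij.1 + ij.2 = k) =
        Finset.HasAntidiagonal.antidiagonal k := by
      ext ⟨i, j⟩
      simp only [Finset.mem_filter, Finset.mem_product, Finset.mem_range,
        Finset.HasAntidiagonal.mem_antidiagonal]
      omega
    rw [hset, (Commute.all s t).add_pow', Finset.sum_div, Finset.sum_mul]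
    refine Finset.sum_congr rfl fun ij hij => ?_
    rw [Finset.HasAntidiagonal.mem_antidiagonal] at hij
    rw [← Function.iterate_add_apply, add_comm ij.2 ij.1, hij, nsmul_eq_mul, ← hij,
      Nat.cast_add_choose]
    have h1 : ((ij.1 + ij.2).factorial : K) ≠ 0 := by exact_mod_cast Nat.factorial_ne_zero _
    field_simp
  · intro ij hij
    exact Finset.mem_range.2 (Finset.mem_filter.1 hij).2
  · intro ij _ hne
    by_contra hlt
    refine hne ?_
    rw [← Function.iterate_add_apply, add_comm,
      Function.iterate_eq_zero_of_le (map_zero δ) (not_lt.1 hlt) hN]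
    simp

/-- The `𝔾ₐ`-action `s ↦ exp(s δ)`. -/
noncomputable def expAction (hδ : δ.IsLocallyNilpotent) : GaAction K A where
  act :=
    { toFun := fun s =>
        { toFun := hδ.expPoint s.toAdd
          invFun := hδ.expPoint (-s.toAdd)
          left_inv := fun x => by rw [← expPoint_add, neg_add_cancel, expPoint_zero]
          right_inv := fun x => by rw [← expPoint_add, add_neg_cancel, expPoint_zero] }
      map_one' := Equiv.ext fun x => hδ.expPoint_zero x
      map_mul' := fun s t => Equiv.ext fun x => hδ.expPoint_add s.toAdd t.toAdd x }
  regular f := ⟨hδ.expPoly f, fun _ _ => rfl⟩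

theorem isExpOf_expAction (hδ : δ.IsLocallyNilpotent) : hδ.expAction.IsExpOf δ :=
  fun _ _ hN s x => hδ.value_expPoint hN s x

/-- Functions killed by the derivation are invariant. -/
theorem value_expPoint_of_apply_eq_zero (hδ : δ.IsLocallyNilpotent) {f : A} (hf : δ f = 0)
    (s : K) (x : Points K A) : value f (hδ.expPoint s x) = value f x := by
  rw [hδ.value_expPoint (N := 1) hf]
  simp

end Derivation.IsLocallyNilpotent

/-- A derivation of a domain whose values are all divisible by `u` can be divided by `u`. -/
theorem Derivation.exists_mul_eq_of_forall_dvd {K A : Type*} [CommRing K] [CommRing A] [IsDomain A]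
    [Algebra K A] (D : Derivation K A A) {u : A} (hu : u ≠ 0) (h : ∀ f, u ∣ D f) :
    ∃ δ : Derivation K A A, ∀ f, u * δ f = D f := by
  choose e he using h
  refine ⟨Derivation.mk'
    { toFun := e
      map_add' := fun f g => mul_left_cancel₀ hu ?_
      map_smul' := fun c f => mul_left_cancel₀ hu ?_ } fun f g => mul_left_cancel₀ hu ?_,
    fun f => (he f).symm⟩
  · rw [← he, mul_add, ← he, ← he, map_add]
  · rw [← he, RingHom.id_apply, mul_smul_comm, ← he, map_smul]
  · simp only [LinearMap.coe_mk, AddHom.coe_mk, smul_eq_mul]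
    rw [← he, Derivation.leibniz, he, he, smul_eq_mul, smul_eq_mul]
    ring

/-! ### The Euler derivation. -/

namespace GmAction

open LaurentPolynomial Points

variable {K A : Type*} [Field K] [CommRing A] [Algebra K A] [IsAlgClosed K] [CharZero K]
  [IsDomain A] [Algebra.FiniteType K A]

section Euler

variable (ρ : GmAction K A)

/-- The sum of the homogeneous components of a function, multiplied by their weights. -/
noncomputable def weightedSum : A →+ A where
  toFun f := (ρ.coact f).coeff.sum fun i a => (i : K) • a
  map_zero' := by simp
  map_add' f g := by
    rw [map_add, AddMonoidAlgebra.coeff_add]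
    exact Finsupp.sum_add_index' (by simp) (by simp)

variable {ρ} in
theorem weightedSum_of_mem {i : ℤ} {f : A} (hf : f ∈ ρ.weightSpace i) :
    ρ.weightedSum f = (i : K) • f := by
  change (ρ.coact f).coeff.sum (fun i a => (i : K) • a) = _
  rw [coact_of_mem hf, AddMonoidAlgebra.coeff_single, Finsupp.sum_single_index (by simp)]

/-- The Euler derivation, multiplication by `i` on the functions of weight `i`. -/
noncomputable def euler : Derivation K A A :=
  Derivation.mk'
    { ρ.weightedSum with
      map_smul' := fun c f => by
        induction f using ρ.weightSpace_induction with
        | mem i f hf =>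
          change ρ.weightedSum _ = c • ρ.weightedSum _
          rw [weightedSum_of_mem hf, weightedSum_of_mem ((ρ.weightSpace i).smul_mem c hf),
            smul_comm]
        | add f g hf hg =>
          change ρ.weightedSum _ = c • ρ.weightedSum _ at hf
          change ρ.weightedSum _ = c • ρ.weightedSum _ at hg
          change ρ.weightedSum _ = c • ρ.weightedSum _
          rw [smul_add, map_add, map_add, hf, hg, smul_add] }
    fun f g => by
      change ρ.weightedSum _ = f • ρ.weightedSum _ + g • ρ.weightedSum _
      simp only [smul_eq_mul]
      induction f using ρ.weightSpace_induction with
      | mem i f hf =>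
        induction g using ρ.weightSpace_induction with
        | mem j g hg =>
          rw [weightedSum_of_mem hf, weightedSum_of_mem hg,
            weightedSum_of_mem (mul_mem_weightSpace hf hg), mul_smul_comm, mul_smul_comm,
            mul_comm g f, ← add_smul, Int.cast_add, add_comm]
        | add g₁ g₂ h₁ h₂ =>
          rw [mul_add, map_add, map_add, h₁, h₂]
          ring
      | add f₁ f₂ h₁ h₂ =>
        rw [add_mul, map_add, map_add, h₁, h₂]
        ring

variable {ρ}

theorem euler_of_mem {i : ℤ} {f : A} (hf : f ∈ ρ.weightSpace i) : ρ.euler f = (i : K) • f :=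
  weightedSum_of_mem hf

theorem euler_of_mem_zero {f : A} (hf : f ∈ ρ.weightSpace 0) : ρ.euler f = 0 := by
  simp [euler_of_mem hf]

theorem component_euler (i : ℤ) (f : A) :
    ρ.component i (ρ.euler f) = (i : K) • ρ.component i f := by
  induction f using ρ.weightSpace_induction with
  | mem j f hf =>
    rw [euler_of_mem hf]
    have hs := (ρ.weightSpace j).smul_mem (j : K) hf
    obtain rfl | hij := eq_or_ne i j
    · rw [component_of_mem hf, component_of_mem hs]
    · rw [component_of_mem_of_ne hf hij, component_of_mem_of_ne hs hij, smul_zero]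
  | add f g hf hg => rw [map_add, component_add, component_add, hf, hg, smul_add]

theorem mem_weightSpace_of_component_eq_zero {i : ℤ} {f : A}
    (h : ∀ j, j ≠ i → ρ.component j f = 0) : f ∈ ρ.weightSpace i := by
  rw [← ρ.sum_component f]
  refine sum_mem fun j _ => ?_
  obtain rfl | hj := eq_or_ne j i
  · exact ρ.component_mem j f
  · rw [h j hj]
    exact zero_mem _

theorem euler_eq_zero_iff {f : A} : ρ.euler f = 0 ↔ f ∈ ρ.weightSpace 0 := by
  refine ⟨fun h => mem_weightSpace_of_component_eq_zero fun j hj => ?_, euler_of_mem_zero⟩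
  have h1 := component_euler (ρ := ρ) j f
  rw [h, component_of_mem_of_ne (ρ := ρ) (i := j + 1) (zero_mem _) (by omega), eq_comm,
    smul_eq_zero] at h1
  exact h1.resolve_left (by exact_mod_cast hj)

end Euler

/-! ### Uniformizers and divisibility of the Euler derivation. -/

section Uniformizer

variable {ρ : GmAction K A}

/-- A function `u` of weight `d` such that up to invariant factors, homogeneous functions are the
powers of `u`. -/
structure IsUniformizer (ρ : GmAction K A) (d : ℤ) (u : A) : Prop where
  isUnit : IsUnit d
  ne_zero : u ≠ 0
  mem : u ∈ ρ.weightSpace d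
  exists_mul_eq : ∀ (i : ℤ) (f : A), f ∈ ρ.weightSpace i → f ≠ 0 → ∃ (m : ℕ) (p q : A),
    i = m * d ∧ p ∈ ρ.weightSpace 0 ∧ q ∈ ρ.weightSpace 0 ∧ q ≠ 0 ∧ q * f = p * u ^ m

namespace IsUniformizer

variable {d : ℤ} {u : A}

theorem exists_mul_mem_adjoin (hu : ρ.IsUniformizer d u) (f : A) :
    ∃ h ∈ ρ.weightSpace 0, h ≠ 0 ∧
      h * f ∈ Algebra.adjoin K (insert u (ρ.weightSpace 0 : Set A)) := by
  induction f using ρ.weightSpace_induction with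
  | mem i f hf =>
    obtain rfl | hf0 := eq_or_ne f 0
    · exact ⟨1, one_mem_weightSpace, one_ne_zero, by simp⟩
    obtain ⟨m, p, q, -, hp, hq, hq0, h⟩ := hu.exists_mul_eq i f hf hf0
    refine ⟨q, hq, hq0, h ▸ mul_mem ?_ (pow_mem ?_ m)⟩
    · exact Algebra.subset_adjoin (Set.mem_insert_of_mem _ hp)
    · exact Algebra.subset_adjoin (Set.mem_insert _ _)
  | add f g hf hg =>
    obtain ⟨a, ha, ha0, haf⟩ := hf
    obtain ⟨b, hb, hb0, hbg⟩ := hg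
    refine ⟨a * b, mul_mem_weightSpace_left ha hb, mul_ne_zero ha0 hb0, ?_⟩
    rw [show a * b * (f + g) = b * (a * f) + a * (b * g) by ring]
    exact add_mem (mul_mem (Algebra.subset_adjoin (Set.mem_insert_of_mem _ hb)) haf)
      (mul_mem (Algebra.subset_adjoin (Set.mem_insert_of_mem _ ha)) hbg)

/-- One `h` clears the denominators of finitely many algebra generators. Arbitrary elements could
need higher powers of `h`, but generators suffice for checking divisibility of a derivation or
equality of two points. -/
theorem exists_forall_mul_mem_adjoin (hu : ρ.IsUniformizer d u) :
    ∃ h ∈ ρ.weightSpace 0, h ≠ 0 ∧ Algebra.adjoin K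
      {f | h * f ∈ Algebra.adjoin K (insert u (ρ.weightSpace 0 : Set A))} = ⊤ := by
  classical
  obtain ⟨G, hG⟩ := (Algebra.FiniteType.out : (⊤ : Subalgebra K A).FG)
  have key : ∀ s : Finset A, ∃ h ∈ ρ.weightSpace 0, h ≠ 0 ∧ ∀ f ∈ s,
      h * f ∈ Algebra.adjoin K (insert u (ρ.weightSpace 0 : Set A)) := by
    intro s
    induction s using Finset.induction_on with
    | empty => exact ⟨1, one_mem_weightSpace, one_ne_zero, by simp⟩
    | insert f s _ ih =>
      obtain ⟨a, ha, ha0, haf⟩ := ih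
      obtain ⟨b, hb, hb0, hbf⟩ := hu.exists_mul_mem_adjoin f
      refine ⟨a * b, mul_mem_weightSpace_left ha hb, mul_ne_zero ha0 hb0, fun g hg => ?_⟩
      obtain rfl | hg := Finset.mem_insert.1 hg
      · rw [mul_assoc]
        exact mul_mem (Algebra.subset_adjoin (Set.mem_insert_of_mem _ ha)) hbf
      · rw [mul_comm a b, mul_assoc]
        exact mul_mem (Algebra.subset_adjoin (Set.mem_insert_of_mem _ hb)) (haf g hg)
  obtain ⟨h, hh, hh0, hmem⟩ := key G
  exact ⟨h, hh, hh0, top_le_iff.1 (hG ▸ Algebra.adjoin_mono hmem)⟩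

theorem dvd_euler_of_mem_adjoin (hu : ρ.IsUniformizer d u) {f : A}
    (hf : f ∈ Algebra.adjoin K (insert u (ρ.weightSpace 0 : Set A))) : u ∣ ρ.euler f := by
  induction hf using Algebra.adjoin_induction with
  | mem f hf =>
    obtain rfl | hf := hf
    · rw [euler_of_mem hu.mem, Algebra.smul_def]
      exact dvd_mul_left _ _
    · rw [euler_of_mem_zero hf]
      exact dvd_zero _
  | algebraMap c => simp
  | add f g _ _ hf hg => rw [map_add]; exact dvd_add hf hg
  | mul f g _ _ hf hg =>
    rw [Derivation.leibniz]
    exact dvd_add (hg.mul_left f) (hf.mul_left g)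

/-- The Leibniz rule makes the set of such `f` a subalgebra, so generators suffice. On these `h * E
f = E (h * f)`, and `u` divides the values of `E` on `A_0[u]` since `E` kills `A_0` and scales `u`.
-/
theorem dvd_mul_euler (hu : ρ.IsUniformizer d u) {h : A} (hh : h ∈ ρ.weightSpace 0)
    (hadj : Algebra.adjoin K
      {f | h * f ∈ Algebra.adjoin K (insert u (ρ.weightSpace 0 : Set A))} = ⊤) (f : A) :
    u ∣ h * ρ.euler f := by
  have hf : f ∈ Algebra.adjoin K
      {f | h * f ∈ Algebra.adjoin K (insert u (ρ.weightSpace 0 : Set A))} := hadj ▸ trivial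
  induction hf using Algebra.adjoin_induction with
  | mem f hf =>
    have h1 := hu.dvd_euler_of_mem_adjoin hf
    rwa [Derivation.leibniz, euler_of_mem_zero hh, smul_zero, add_zero] at h1
  | algebraMap c => simp
  | add f g _ _ hf hg => rw [map_add, mul_add]; exact dvd_add hf hg
  | mul f g _ _ hf hg =>
    rw [Derivation.leibniz, mul_add, smul_eq_mul, smul_eq_mul, mul_left_comm, mul_left_comm h g]
    exact dvd_add (hg.mul_left f) (hf.mul_left g)

omit [IsAlgClosed K] [CharZero K] [IsDomain A] [Algebra.FiniteType K A] in
/-- Two points coincide as soon as `u` and all invariant functions take the same values. -/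
theorem point_ext (hu : ρ.IsUniformizer d u) {h : A} (hh : h ∈ ρ.weightSpace 0)
    (hadj : Algebra.adjoin K
      {f | h * f ∈ Algebra.adjoin K (insert u (ρ.weightSpace 0 : Set A))} = ⊤)
    {x y : Points K A} (hx : value h x ≠ 0)
    (hinv : ∀ f ∈ ρ.weightSpace 0, value f x = value f y) (hxy : value u x = value u y) :
    x = y := by
  have h1 : ∀ f ∈ Algebra.adjoin K (insert u (ρ.weightSpace 0 : Set A)),
      value f x = value f y := by
    intro f hf
    induction hf using Algebra.adjoin_induction with
    | mem f hf =>
      obtain rfl | hf := hf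
      · exact hxy
      · exact hinv f hf
    | algebraMap c => simp
    | add f g _ _ hf hg => simp [hf, hg]
    | mul f g _ _ hf hg => simp [hf, hg]
  ext f
  have hf : f ∈ Algebra.adjoin K
      {f | h * f ∈ Algebra.adjoin K (insert u (ρ.weightSpace 0 : Set A))} := hadj ▸ trivial
  induction hf using Algebra.adjoin_induction with
  | mem f hf =>
    have h2 := h1 _ hf
    rw [value_mul, value_mul, ← hinv h hh] at h2
    exact mul_left_cancel₀ hx h2
  | algebraMap c => simp
  | add f g _ _ hf hg => simp [hf, hg]
  | mul f g _ _ hf hg => simp [hf, hg]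

end IsUniformizer

end Uniformizer

/-! ### Conjugating exponentials by the torus. -/

section Compatibility

variable {ρ : GmAction K A}

-- Since `δ` has degree `d`, conjugation by `t` rescales it by `t ^ (-d)`, and this only changes the
-- parameter `s`.
open Derivation.IsLocallyNilpotent in
theorem act_expPoint {δ : Derivation K A A} (hδ : δ.IsLocallyNilpotent) {d : ℤ}
    (hd : ∀ (i : ℤ), ∀ f ∈ ρ.weightSpace i, δ f ∈ ρ.weightSpace (i + d)) (t : Kˣ) (s : K)
    (x : Points K A) :
    ρ.act t (hδ.expPoint s x) = hδ.expPoint (s * ((t ^ (-d) : Kˣ) : K)) (ρ.act t x) := by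
  ext f
  induction f using ρ.weightSpace_induction with
  | mem i f hf =>
    obtain ⟨N, hN⟩ := hδ f
    have hn : ∀ n : ℕ, (⇑δ)^[n] f ∈ ρ.weightSpace (i + n * d) := by
      intro n
      induction n with
      | zero => simpa using hf
      | succ n ih =>
        rw [Function.iterate_succ_apply']
        convert hd _ _ ih using 2
        push_cast
        ring
    rw [hf t, hδ.value_expPoint hN, hδ.value_expPoint hN, Finset.mul_sum]
    refine Finset.sum_congr rfl fun n _ => ?_
    rw [hn n t x, zpow_add, mul_pow, ← Units.val_pow_eq_pow_val, ← zpow_natCast (t ^ (-d)),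
      ← zpow_mul, Units.val_mul, show -d * (n : ℤ) = -(n * d) by ring, zpow_neg]
    have : ((t ^ (n * d : ℤ) : Kˣ) : K) ≠ 0 := Units.ne_zero _
    rw [Units.val_inv_eq_inv_val]
    field_simp
  | add f g hf hg => rw [value_add, value_add, hf, hg]

theorem conj_expAction_mem_range {δ : Derivation K A A} (hδ : δ.IsLocallyNilpotent) {d : ℤ}
    (hd : ∀ (i : ℤ), ∀ f ∈ ρ.weightSpace i, δ f ∈ ρ.weightSpace (i + d)) (t : Kˣ)
    {φ : Equiv.Perm (Points K A)} (hφ : φ ∈ hδ.expAction.act.range) :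
    ρ.act t * φ * (ρ.act t)⁻¹ ∈ hδ.expAction.act.range := by
  obtain ⟨s, rfl⟩ := hφ
  refine ⟨Multiplicative.ofAdd (s.toAdd * ((t ^ (-d) : Kˣ) : K)), Equiv.ext fun x => ?_⟩
  refine Eq.trans ?_ (act_expPoint hδ hd t s.toAdd ((ρ.act t)⁻¹ x)).symm
  rw [← Equiv.Perm.mul_apply, mul_inv_cancel, Equiv.Perm.one_apply]
  rfl

/-- The exponentials of a homogeneous locally nilpotent derivation are normalized by `𝔾ₘ`. -/
theorem normalizes_expAction {δ : Derivation K A A} (hδ : δ.IsLocallyNilpotent) {d : ℤ}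
    (hd : ∀ (i : ℤ), ∀ f ∈ ρ.weightSpace i, δ f ∈ ρ.weightSpace (i + d)) (t : Kˣ) :
    hδ.expAction.act.range.map (MulAut.conj (ρ.act t)).toMonoidHom = hδ.expAction.act.range := by
  refine le_antisymm ?_ fun φ hφ => ?_
  · rintro _ ⟨φ, hφ, rfl⟩
    exact conj_expAction_mem_range hδ hd t hφ
  · refine ⟨_, conj_expAction_mem_range hδ hd t⁻¹ hφ, ?_⟩
    simp [mul_assoc]

end Compatibility

end GmAction

/-! ### The derivation `δ = h E / u` and its orbits. -/

namespace GmAction.IsUniformizer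

open LaurentPolynomial Points Derivation.IsLocallyNilpotent

variable {K A : Type*} [Field K] [CommRing A] [Algebra K A] [IsAlgClosed K] [CharZero K]
  [IsDomain A] [Algebra.FiniteType K A] {ρ : GmAction K A} {d : ℤ} {u h : A} {δ : Derivation K A A}

theorem derivation_mem_weightSpace (hu : ρ.IsUniformizer d u) (hh : h ∈ ρ.weightSpace 0)
    (hδ : ∀ f, u * δ f = h * ρ.euler f) (i : ℤ) (f : A) (hf : f ∈ ρ.weightSpace i) :
    δ f ∈ ρ.weightSpace (i + -d) := by
  refine mem_weightSpace_of_mul_mem hu.ne_zero hu.mem ?_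
  rw [mul_comm, hδ, euler_of_mem hf, neg_add_cancel_right]
  exact mul_mem_weightSpace_left hh ((ρ.weightSpace i).smul_mem _ hf)

theorem derivation_eq_zero_iff (hu : ρ.IsUniformizer d u) (h0 : h ≠ 0)
    (hδ : ∀ f, u * δ f = h * ρ.euler f) (f : A) : δ f = 0 ↔ f ∈ ρ.weightSpace 0 := by
  rw [← euler_eq_zero_iff, ← mul_right_inj' h0 (b := ρ.euler f), ← hδ, mul_zero, mul_eq_zero,
    or_iff_right hu.ne_zero]

/-- The only weights are `m * d` with `m : ℕ`, and `δ` sends weight `(m + 1) * d` to weight `m * d`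
and kills weight `0`. -/
theorem isLocallyNilpotent_derivation (hu : ρ.IsUniformizer d u) (hh : h ∈ ρ.weightSpace 0)
    (h0 : h ≠ 0) (hδ : ∀ f, u * δ f = h * ρ.euler f) : δ.IsLocallyNilpotent := by
  have key : ∀ (m : ℕ) (f : A), f ∈ ρ.weightSpace (m * d) → (⇑δ)^[m + 1] f = 0 := by
    intro m
    induction m with
    | zero => exact fun f hf => (hu.derivation_eq_zero_iff h0 hδ f).2 (by simpa using hf)
    | succ m ih =>
      intro f hf
      rw [Function.iterate_succ_apply]
      refine ih _ ?_
      convert hu.derivation_mem_weightSpace hh hδ _ f hf using 2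
      push_cast
      ring
  intro f
  induction f using ρ.weightSpace_induction with
  | mem i f hf =>
    obtain rfl | hf0 := eq_or_ne f 0
    · exact ⟨0, rfl⟩
    · obtain ⟨m, -, -, rfl, -⟩ := hu.exists_mul_eq i f hf hf0
      exact ⟨m + 1, key m f hf⟩
  | add f g hf hg =>
    obtain ⟨a, ha⟩ := hf
    obtain ⟨b, hb⟩ := hg
    refine ⟨a + b, ?_⟩
    rw [iterate_map_add, Function.iterate_eq_zero_of_le (map_zero δ) (Nat.le_add_right a b) ha,
      Function.iterate_eq_zero_of_le (map_zero δ) (Nat.le_add_left b a) hb, add_zero]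

theorem derivation_uniformizer (hu : ρ.IsUniformizer d u)
    (hδ : ∀ f, u * δ f = h * ρ.euler f) : δ u = (d : K) • h := by
  refine mul_left_cancel₀ hu.ne_zero ?_
  rw [hδ, euler_of_mem hu.mem, mul_smul_comm, mul_smul_comm, mul_comm]

theorem value_uniformizer_expPoint (hu : ρ.IsUniformizer d u) (hh : h ∈ ρ.weightSpace 0)
    (h0 : h ≠ 0) (hδ : ∀ f, u * δ f = h * ρ.euler f) (hnil : δ.IsLocallyNilpotent) (s : K)
    (x : Points K A) :
    value u (hnil.expPoint s x) = value u x + s * (d * value h x) := by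
  rw [hnil.value_expPoint (N := 2)]
  · simp [Finset.sum_range_succ, hu.derivation_uniformizer hδ]
  · change δ (δ u) = 0
    rw [hu.derivation_uniformizer hδ, Derivation.map_smul, (hu.derivation_eq_zero_iff h0 hδ h).2 hh,
      smul_zero]

/-- The closure of a generic `𝔾ₘ`-orbit is an orbit of the exponentials of the derivation. -/
theorem orbit_expAction_eq_closure (hu : ρ.IsUniformizer d u) (hh : h ∈ ρ.weightSpace 0)
    (hadj : Algebra.adjoin K
      {f | h * f ∈ Algebra.adjoin K (insert u (ρ.weightSpace 0 : Set A))} = ⊤)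
    (h0 : h ≠ 0) (hδ : ∀ f, u * δ f = h * ρ.euler f) (hnil : δ.IsLocallyNilpotent)
    {x : Points K A} (hx : value h x ≠ 0) (hux : value u x ≠ 0) :
    hnil.expAction.orbit x = closure (ρ.orbit x) := by
  have hd0 : (d : K) ≠ 0 := by exact_mod_cast hu.isUnit.ne_zero
  have hinv : ∀ (s : K), ∀ f ∈ ρ.weightSpace 0, value f (hnil.expPoint s x) = value f x :=
    fun s f hf => hnil.value_expPoint_of_apply_eq_zero
      ((hu.derivation_eq_zero_iff h0 hδ f).2 hf) s x
  have hval := fun s => hu.value_uniformizer_expPoint hh h0 hδ hnil s x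
  apply Set.Subset.antisymm
  · rintro _ ⟨s, rfl⟩
    change hnil.expPoint s.toAdd x ∈ _
    rw [mem_closure_iff_value]
    intro g hg
    have hGm : ∀ s : K, value u (hnil.expPoint s x) ≠ 0 → value g (hnil.expPoint s x) = 0 := by
      intro s hs
      -- The torus parameter is `w ^ d`: it scales `u` by `w ^ (d * d) = w`, as `d = ±1`.
      let w : Kˣ := Units.mk0 (value u (hnil.expPoint s x) / value u x) (div_ne_zero hs hux)
      have hpt : ρ.act (w ^ d) x = hnil.expPoint s x := by
        refine hu.point_ext hh hadj ?_ (fun f hf => ?_) ?_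
        · rwa [value_act_of_mem_zero hh]
        · rw [value_act_of_mem_zero hf, hinv s f hf]
        · rw [hu.mem, ← zpow_mul, Int.isUnit_mul_self hu.isUnit, zpow_one, Units.val_mk0,
            div_mul_cancel₀ _ hux]
      rw [← hpt]
      exact hg _ ⟨w ^ d, rfl⟩
    -- `q` is `u` along the `𝔾ₐ`-orbit. As `g` vanishes there wherever `u` does not, the product of
    -- the two polynomials is zero, so `g` also vanishes at the point missed by the torus.
    let q : K[X] := Polynomial.C (value u x) + Polynomial.X * Polynomial.C (d * value h x)
    have hq : q ≠ 0 := fun hq => hux (by simpa [q] using congrArg (Polynomial.eval 0) hq)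
    have hprod : (hnil.expPoly g).map x.evalHom * q = 0 := by
      refine Polynomial.funext fun s => ?_
      rw [Polynomial.eval_mul, Polynomial.eval_map, ← hnil.value_expPoint_eq_eval₂,
        Polynomial.eval_zero, show q.eval s = value u (hnil.expPoint s x) by
          rw [hval]; simp [q]]
      by_cases hs : value u (hnil.expPoint s x) = 0
      · rw [hs, mul_zero]
      · rw [hGm s hs, zero_mul]
    rw [hnil.value_expPoint_eq_eval₂, ← Polynomial.eval_map,
      (mul_eq_zero.1 hprod).resolve_right hq, Polynomial.eval_zero]
  · intro y hy
    have hyinv : ∀ f ∈ ρ.weightSpace 0, value f y = value f x :=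
      fun f hf => value_eq_of_mem_closure_orbit hf hy
    have hdh : d * value h x ≠ 0 := mul_ne_zero hd0 hx
    -- The parameter solves `u x + s * (d * h x) = u y`; invariants already agree on the orbit
    -- closure.
    refine ⟨Multiplicative.ofAdd ((value u y - value u x) / (d * value h x)), ?_⟩
    change hnil.expPoint _ x = y
    refine hu.point_ext hh hadj ?_ (fun f hf => ?_) ?_
    · rwa [hinv _ h hh]
    · rw [hinv _ f hf, hyinv f hf]
    · rw [hval, toAdd_ofAdd, div_mul_cancel₀ _ hdh]
      ring

theorem exists_compatible_expAction (hu : ρ.IsUniformizer d u) :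
    ∃ (σ : GaAction K A) (δ : Derivation K A A), σ.IsCompatible ρ ∧ σ.IsExpOf δ ∧
      δ.IsLocallyNilpotent ∧ δ.IsHomogeneousFor ρ ∧
      LinearMap.ker (δ : A →ₗ[K] A) = ρ.weightSpace 0 := by
  obtain ⟨h, hh, h0, hadj⟩ := hu.exists_forall_mul_mem_adjoin
  obtain ⟨δ, hδ⟩ := (h • ρ.euler).exists_mul_eq_of_forall_dvd hu.ne_zero
    (hu.dvd_mul_euler hh hadj)
  have hδ' : ∀ f, u * δ f = h * ρ.euler f := hδ
  have hnil := hu.isLocallyNilpotent_derivation hh h0 hδ'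
  have hhom := hu.derivation_mem_weightSpace hh hδ'
  refine ⟨hnil.expAction, δ, ⟨normalizes_expAction hnil hhom, ?_⟩, hnil.isExpOf_expAction, hnil,
    ⟨-d, hhom⟩, ?_⟩
  · refine ⟨{x | value (h * u) x ≠ 0}, isOpen_value_ne_zero _,
      exists_value_ne_zero K (mul_ne_zero h0 hu.ne_zero), fun x hx => ?_⟩
    rw [Set.mem_ofPred_eq, value_mul] at hx
    exact hu.orbit_expAction_eq_closure hh hadj h0 hδ' hnil (left_ne_zero_of_mul hx)
      (right_ne_zero_of_mul hx)
  · ext f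
    exact hu.derivation_eq_zero_iff h0 hδ' f

end GmAction.IsUniformizer

/-! ### From a fixed divisor to a uniformizer. -/

namespace GmAction

open LaurentPolynomial Points

variable {K A : Type*} [Field K] [CommRing A] [Algebra K A] [IsAlgClosed K] [CharZero K]
  [IsDomain A] [Algebra.FiniteType K A] {ρ : GmAction K A}

omit [IsAlgClosed K] [IsDomain A] [Algebra.FiniteType K A] in
/-- Functions of nonzero weight vanish at fixed points. -/
theorem value_eq_zero_of_fixed {x : Points K A} (hx : ∀ t : Kˣ, ρ.act t x = x) {i : ℤ}
    (hi : i ≠ 0) {f : A} (hf : f ∈ ρ.weightSpace i) : value f x = 0 := by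
  by_contra hne
  refine hi (zpow_right_injective₀ (a := (2 : ℚ)) (by norm_num) (by norm_num) ?_)
  have h := hf (Units.mk0 (2 : K) two_ne_zero) x
  rw [hx, eq_comm, mul_eq_right₀ hne, Units.val_zpow_eq_zpow_val, Units.val_mk0] at h
  refine Rat.cast_injective (α := K) ?_
  push_cast
  exact h

theorem _root_.HasFixedPrimeDivisor.exists_isUniformizer [IsIntegrallyClosed A]
    (hρ : ρ.IsEffective) (h : HasFixedPrimeDivisor ρ) :
    ∃ (d : ℤ) (u : A), ρ.IsUniformizer d u := by
  obtain ⟨D, hD, hfix⟩ := h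
  obtain ⟨P, hP⟩ := (primeSpectrumOrderIso K A).surjective (OrderDual.toDual D)
  obtain rfl : zeroLocus P = D := hP
  rw [coheight_zeroLocus] at hD
  have hI : ∀ (i : ℤ) (f : A), i ≠ 0 → f ∈ ρ.weightSpace i → f ∈ P.asIdeal := by
    intro i f hi hf
    by_contra hfP
    obtain ⟨x, hx, hfx⟩ := exists_forall_mem_value_eq_zero (K := K) P.asIdeal hfP
    exact hfx (value_eq_zero_of_fixed (hfix x hx) hi hf)
  obtain ⟨d, u, h1, h2, h3, h4⟩ := exists_uniformizer hρ P.asIdeal hD hI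
  exact ⟨d, u, h1, h2, h3, h4⟩

end GmAction

/-! ### Restricting functions to additive orbits. -/

theorem Polynomial.coeff_taylor_of_natDegree_le {R : Type*} [CommSemiring R] (r : R) {p : R[X]}
    {n : ℕ} (h : p.natDegree ≤ n) : (Polynomial.taylor r p).coeff n = p.coeff n := by
  obtain rfl | hlt := h.eq_or_lt
  · rw [Polynomial.coeff_taylor_natDegree, Polynomial.leadingCoeff]
  · rw [Polynomial.coeff_eq_zero_of_natDegree_lt hlt,
      Polynomial.coeff_eq_zero_of_natDegree_lt (by rwa [Polynomial.natDegree_taylor])]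

theorem Polynomial.eq_C_mul_X_sub_C_pow_of_forall_root_eq {K : Type*} [Field K] [IsAlgClosed K]
    {p : K[X]} {r : K} (h : ∀ s ∈ p.roots, s = r) :
    p = Polynomial.C p.leadingCoeff * (Polynomial.X - Polynomial.C r) ^ p.natDegree := by
  have hsplit := IsAlgClosed.splits p
  have hroots : p.roots = Multiset.replicate p.natDegree r :=
    Multiset.eq_replicate.2 ⟨hsplit.natDegree_eq_card_roots.symm, h⟩
  conv_lhs => rw [hsplit.eq_prod_roots, hroots]
  rw [Multiset.map_replicate, Multiset.prod_replicate]

namespace GaAction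

open Points

variable {K A : Type*} [Field K] [CommRing A] [Algebra K A] (σ : GaAction K A)

/-- The translate of a point by `s`. -/
def translate (s : K) (x : Points K A) : Points K A := σ.act (Multiplicative.ofAdd s) x

theorem translate_mem_orbit (s : K) (x : Points K A) : σ.translate s x ∈ σ.orbit x := ⟨_, rfl⟩

theorem translate_zero (x : Points K A) : σ.translate 0 x = x := by
  simp [translate]

theorem translate_add (s t : K) (x : Points K A) :
    σ.translate (s + t) x = σ.translate s (σ.translate t x) := by
  simp [translate, ofAdd_add]

theorem translate_nsmul_of_eq {s : K} {x : Points K A} (h : σ.translate s x = x) (n : ℕ) :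
    σ.translate (n * s) x = x := by
  induction n with
  | zero => simpa using σ.translate_zero x
  | succ n ih => rw [Nat.cast_succ, add_mul, one_mul, translate_add, h, ih]

/-- The pullback of a function along the action map `𝔾ₐ × X → X`. -/
noncomputable def coact (f : A) : A[X] := (σ.regular f).choose

/-- The restriction of a function to an orbit. -/
noncomputable def orbitPoly (f : A) (x : Points K A) : K[X] := (σ.coact f).map x.evalHom

theorem eval_orbitPoly (f : A) (s : K) (x : Points K A) :
    (σ.orbitPoly f x).eval s = value f (σ.translate s x) := by
  rw [orbitPoly, Polynomial.eval_map]
  exact ((σ.regular f).choose_spec s x).symm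

theorem eval_zero_orbitPoly (f : A) (x : Points K A) :
    (σ.orbitPoly f x).eval 0 = value f x := by
  rw [eval_orbitPoly, translate_zero]

/-- The leading coefficient of the pullback of a function along the action map. -/
noncomputable def leadingCoeff (f : A) : A := (σ.coact f).leadingCoeff

/-- The degree of a generic restriction of a function to an orbit. -/
noncomputable def degree (f : A) : ℕ := (σ.coact f).natDegree

variable {σ}

theorem natDegree_orbitPoly {f : A} {x : Points K A} (hx : value (σ.leadingCoeff f) x ≠ 0) :
    (σ.orbitPoly f x).natDegree = σ.degree f :=
  Polynomial.natDegree_map_of_leadingCoeff_ne_zero _ hx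

theorem leadingCoeff_orbitPoly {f : A} {x : Points K A} (hx : value (σ.leadingCoeff f) x ≠ 0) :
    (σ.orbitPoly f x).leadingCoeff = value (σ.leadingCoeff f) x :=
  Polynomial.leadingCoeff_map_of_leadingCoeff_ne_zero _ hx

theorem orbitPoly_ne_zero {f : A} {x : Points K A} (hx : value (σ.leadingCoeff f) x ≠ 0) :
    σ.orbitPoly f x ≠ 0 := by
  rw [← Polynomial.leadingCoeff_ne_zero, leadingCoeff_orbitPoly hx]
  exact hx

theorem exists_value_translate_eq_zero [IsAlgClosed K] {f : A} {x : Points K A}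
    (hx : value (σ.leadingCoeff f) x ≠ 0) (hf : σ.degree f ≠ 0) :
    ∃ s, value f (σ.translate s x) = 0 := by
  obtain ⟨s, hs⟩ := IsAlgClosed.exists_root (σ.orbitPoly f x) (by
    intro h
    rw [← natDegree_orbitPoly hx] at hf
    exact hf (Polynomial.natDegree_eq_of_degree_eq_some h))
  exact ⟨s, by rw [← eval_orbitPoly]; exact hs⟩

/-- The leading coefficient of the pullback of a function is an invariant function. -/
theorem value_leadingCoeff_translate [Infinite K] (f : A) (s : K) (x : Points K A) :
    value (σ.leadingCoeff f) (σ.translate s x) = value (σ.leadingCoeff f) x := by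
  have h : σ.orbitPoly f (σ.translate s x) = Polynomial.taylor s (σ.orbitPoly f x) :=
    Polynomial.funext fun r => by
      rw [Polynomial.taylor_eval, eval_orbitPoly, eval_orbitPoly, translate_add]
  -- The coefficient is read at the degree of the pullback, which bounds the degree on every orbit.
  -- So the shift preserves it even where the leading coefficient vanishes.
  have h1 := congrArg (fun p => p.coeff (σ.coact f).natDegree) h
  rw [orbitPoly, orbitPoly, Polynomial.coeff_taylor_of_natDegree_le s Polynomial.natDegree_map_le,
    Polynomial.coeff_map, Polynomial.coeff_map] at h1
  exact h1

theorem leadingCoeff_ne_zero [IsAlgClosed K] [IsDomain A] [Algebra.FiniteType K A] {f : A}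
    (hf : f ≠ 0) : σ.leadingCoeff f ≠ 0 := by
  intro h
  obtain ⟨x, hx⟩ := exists_value_ne_zero K hf
  rw [← σ.eval_zero_orbitPoly, orbitPoly, Polynomial.leadingCoeff_eq_zero.1 h] at hx
  simp at hx

theorem value_translate_of_degree_eq_zero {f : A} (hf : σ.degree f = 0) (s : K)
    (x : Points K A) : value f (σ.translate s x) = value f x := by
  rw [← σ.eval_zero_orbitPoly f x, ← eval_orbitPoly, orbitPoly,
    Polynomial.eq_C_of_natDegree_eq_zero hf]
  simp

end GaAction

/-! ### Weights along generic common orbits. -/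

namespace GmAction

open LaurentPolynomial Points

variable {K A : Type*} [Field K] [CommRing A] [Algebra K A] [IsAlgClosed K] [CharZero K]
  [IsDomain A] [Algebra.FiniteType K A] {ρ : GmAction K A} {σ : GaAction K A}

/-- Functions that are constant along generic `𝔾ₘ`-orbits are invariant. -/
theorem mem_weightSpace_zero_of_forall_value_act {U : Set (Points K A)} (hU : IsOpen U)
    (hne : U.Nonempty) {f : A}
    (h : ∀ x ∈ U, ∀ t : Kˣ, value f (ρ.act t x) = value f x) : f ∈ ρ.weightSpace 0 := by
  intro t x
  have hsum : ∀ y, value f (ρ.act t y) = value (∑ i ∈ (ρ.coact f).coeff.support,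
      ((t ^ i : Kˣ) : K) • ρ.component i f) y := by
    intro y
    rw [value_act_eq_sum, value_sum]
    exact Finset.sum_congr rfl fun i _ => by rw [value_smul, mul_comm]
  rw [zpow_zero, Units.val_one, one_mul, hsum,
    eq_of_value_eq_on_isOpen hU hne fun y hy => (hsum y).symm.trans (h y hy t)]

/-- Degree zero would make `f` constant along `𝔾ₐ`-orbits, hence along generic `𝔾ₘ`-orbits, forcing
weight zero. -/
theorem degree_ne_zero {U : Set (Points K A)} (hU : IsOpen U) (hne : U.Nonempty)
    (horb : ∀ x ∈ U, σ.orbit x = closure (ρ.orbit x)) {i : ℤ} {f : A} (hi : i ≠ 0) (hf0 : f ≠ 0)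
    (hf : f ∈ ρ.weightSpace i) : σ.degree f ≠ 0 := by
  intro hdeg
  refine hi (eq_of_mem_of_mem hf0 hf (mem_weightSpace_zero_of_forall_value_act hU hne ?_))
  intro x hx t
  have hmem : ρ.act t x ∈ σ.orbit x := horb x hx ▸ subset_closure ⟨t, rfl⟩
  obtain ⟨s, hs⟩ := hmem
  rw [← hs]
  exact GaAction.value_translate_of_degree_eq_zero hdeg s.toAdd x

theorem leadingCoeff_mem_weightSpace {U : Set (Points K A)} (hU : IsOpen U) (hne : U.Nonempty)
    (horb : ∀ x ∈ U, σ.orbit x = closure (ρ.orbit x)) (f : A) :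
    σ.leadingCoeff f ∈ ρ.weightSpace 0 := by
  have : Infinite K := IsAlgClosed.instInfinite
  refine mem_weightSpace_zero_of_forall_value_act hU hne ?_
  intro x hx t
  have hmem : ρ.act t x ∈ σ.orbit x := horb x hx ▸ subset_closure ⟨t, rfl⟩
  obtain ⟨s, hs⟩ := hmem
  rw [← hs]
  exact GaAction.value_leadingCoeff_translate f s.toAdd x

/-- Nonzero weights all have the same sign if generic `𝔾ₘ`-orbit closures are `𝔾ₐ`-orbits. -/
theorem mul_pos_of_orbit_eq {U : Set (Points K A)} (hU : IsOpen U) (hne : U.Nonempty)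
    (horb : ∀ x ∈ U, σ.orbit x = closure (ρ.orbit x)) {i j : ℤ} {f g : A} (hi : i ≠ 0)
    (hj : j ≠ 0) (hf0 : f ≠ 0) (hg0 : g ≠ 0) (hf : f ∈ ρ.weightSpace i)
    (hg : g ∈ ρ.weightSpace j) : 0 < i * j := by
  by_contra hneg
  have hneg : i * j < 0 := lt_of_le_of_ne (not_lt.1 hneg) (mul_ne_zero hi hj)
  obtain ⟨x, hxU, hx⟩ := exists_mem_value_ne_zero hU hne (f := σ.leadingCoeff f * f * g)
    (mul_ne_zero (mul_ne_zero (GaAction.leadingCoeff_ne_zero hf0) hf0) hg0)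
  simp only [value_mul] at hx
  have hgx := right_ne_zero_of_mul hx
  have hfx := right_ne_zero_of_mul (left_ne_zero_of_mul hx)
  obtain ⟨s, hs⟩ := GaAction.exists_value_translate_eq_zero
    (left_ne_zero_of_mul (left_ne_zero_of_mul hx)) (degree_ne_zero hU hne horb hi hf0 hf)
  have hy := horb x hxU ▸ σ.translate_mem_orbit s x
  -- With opposite signs the weights of these powers cancel. This invariant is nonzero at `x` but
  -- vanishes where `f` does on the same orbit closure.
  have hinv : f ^ j.natAbs * g ^ i.natAbs ∈ ρ.weightSpace 0 := by
    convert mul_mem_weightSpace (pow_mem_weightSpace hf j.natAbs)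
      (pow_mem_weightSpace hg i.natAbs) using 2
    rcases mul_neg_iff.1 hneg with ⟨h1, h2⟩ | ⟨h1, h2⟩
    · rw [Int.natCast_natAbs, Int.natCast_natAbs, abs_of_neg h2, abs_of_pos h1]; ring
    · rw [Int.natCast_natAbs, Int.natCast_natAbs, abs_of_pos h2, abs_of_neg h1]; ring
  have h := value_eq_of_mem_closure_orbit hinv hy
  rw [value_mul, value_mul, value_pow, value_pow, value_pow, value_pow, hs,
    zero_pow (by simpa using hj), zero_mul] at h
  exact mul_ne_zero (pow_ne_zero _ hfx) (pow_ne_zero _ hgx) h.symm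

omit [IsAlgClosed K] [CharZero K] [IsDomain A] [Algebra.FiniteType K A] in
/-- On a `𝔾ₘ`-orbit closure, functions whose weights have the same sign have the same zeros. -/
theorem value_eq_zero_of_value_eq_zero {i j : ℤ} {f g : A} (hij : 0 < i * j)
    (hf : f ∈ ρ.weightSpace i) (hg : g ∈ ρ.weightSpace j) {x y : Points K A}
    (hy : y ∈ closure (ρ.orbit x)) (hfx : value f x ≠ 0) (hfy : value f y = 0) :
    value g y = 0 := by
  have hi : i ≠ 0 := left_ne_zero_of_mul hij.ne'
  have hj : j ≠ 0 := right_ne_zero_of_mul hij.ne'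
  have hg' : g ^ i.natAbs ∈ ρ.weightSpace (j.natAbs * i) := by
    convert pow_mem_weightSpace hg i.natAbs using 2
    rcases mul_pos_iff.1 hij with ⟨h1, h2⟩ | ⟨h1, h2⟩
    · rw [Int.natCast_natAbs, Int.natCast_natAbs, abs_of_pos h1, abs_of_pos h2]; ring
    · rw [Int.natCast_natAbs, Int.natCast_natAbs, abs_of_neg h1, abs_of_neg h2]; ring
  -- This combination of `g ^ |i|` and `f ^ |j|`, of equal weight, is built to vanish at `x`, hence
  -- on the orbit closure.
  have hmem := sub_mem ((ρ.weightSpace _).smul_mem (value f x ^ j.natAbs) hg')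
    ((ρ.weightSpace _).smul_mem (value g x ^ i.natAbs) (pow_mem_weightSpace hf j.natAbs))
  have h := value_eq_zero_of_mem_closure_orbit hmem (by simp [mul_comm]) hy
  rw [value_sub, value_smul, value_smul, value_pow, value_pow, hfy,
    zero_pow (by simpa using hj), mul_zero, sub_zero] at h
  exact eq_zero_of_pow_eq_zero
    ((mul_eq_zero.1 h).resolve_left (pow_ne_zero _ hfx))

/-- On a generic orbit, homogeneous functions of nonzero weights vanish at the same unique
parameter. -/
theorem eq_of_value_translate_eq_zero
    (hsign : ∀ (i j : ℤ) (f g : A), i ≠ 0 → j ≠ 0 → f ≠ 0 → g ≠ 0 → f ∈ ρ.weightSpace i →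
      g ∈ ρ.weightSpace j → 0 < i * j)
    {x : Points K A} (horb : σ.orbit x = closure (ρ.orbit x)) {i j : ℤ} {f g : A} (hi : i ≠ 0)
    (hj : j ≠ 0) (hf : f ∈ ρ.weightSpace i) (hg : g ∈ ρ.weightSpace j) (hfx : value f x ≠ 0)
    (hgx : value g x ≠ 0) (hlc : value (σ.leadingCoeff f) x ≠ 0) {r s : K}
    (hr : value f (σ.translate r x) = 0) (hs : value g (σ.translate s x) = 0) : s = r := by
  have hf0 : f ≠ 0 := by rintro rfl; simp at hfx
  have hg0 : g ≠ 0 := by rintro rfl; simp at hgx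
  have hyr := horb ▸ σ.translate_mem_orbit r x
  have hys := horb ▸ σ.translate_mem_orbit s x
  -- At both points all functions of nonzero weight vanish and invariants keep their value at `x`,
  -- so the points coincide.
  have hpt : σ.translate s x = σ.translate r x := by
    ext a
    induction a using ρ.weightSpace_induction with
    | mem k a ha =>
      obtain rfl | hk := eq_or_ne k 0
      · rw [value_eq_of_mem_closure_orbit ha hyr, value_eq_of_mem_closure_orbit ha hys]
      obtain rfl | ha0 := eq_or_ne a 0
      · simp
      rw [value_eq_zero_of_value_eq_zero (hsign i k f a hi hk hf0 ha0 hf ha) hf ha hyr hfx hr,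
        value_eq_zero_of_value_eq_zero (hsign j k g a hj hk hg0 ha0 hg ha) hg ha hys hgx hs]
    | add a b h1 h2 => rw [value_add, value_add, h1, h2]
  have hfix : σ.translate (s - r) (σ.translate r x) = σ.translate r x := by
    rw [← σ.translate_add, sub_add_cancel, hpt]
  by_contra hne
  -- If `s ≠ r`, all multiples of `s - r` fix the point, giving the polynomial of `f` infinitely
  -- many roots in characteristic zero.
  refine GaAction.orbitPoly_ne_zero hlc
    (Polynomial.eq_zero_of_infinite_isRoot _ (Set.Infinite.mono ?_ (Set.infinite_range_of_injective
      (f := fun n : ℕ => (n : K) * (s - r) + r) ?_)))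
  · rintro _ ⟨n, rfl⟩
    change (σ.orbitPoly f x).eval _ = 0
    rw [σ.eval_orbitPoly, σ.translate_add, σ.translate_nsmul_of_eq hfix, hr]
  · intro m n hmn
    exact_mod_cast mul_right_cancel₀ (sub_ne_zero.2 hne) (add_right_cancel hmn)

/-- If generic `𝔾ₘ`-orbit closures are `𝔾ₐ`-orbits, homogeneous functions of nonzero weights are
multiplicatively dependent up to invariant factors. -/
theorem exists_mul_pow_eq_mul_pow {U : Set (Points K A)} (hU : IsOpen U) (hne : U.Nonempty)
    (horb : ∀ x ∈ U, σ.orbit x = closure (ρ.orbit x)) {i j : ℤ} {f g : A} (hi : i ≠ 0)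
    (hj : j ≠ 0) (hf0 : f ≠ 0) (hg0 : g ≠ 0) (hf : f ∈ ρ.weightSpace i)
    (hg : g ∈ ρ.weightSpace j) :
    ∃ a ∈ ρ.weightSpace 0, ∃ b ∈ ρ.weightSpace 0, ∃ m n : ℕ, a ≠ 0 ∧ m ≠ 0 ∧
      a * f ^ m = b * g ^ n := by
  have hsign : ∀ (i j : ℤ) (f g : A), i ≠ 0 → j ≠ 0 → f ≠ 0 → g ≠ 0 → f ∈ ρ.weightSpace i →
      g ∈ ρ.weightSpace j → 0 < i * j := fun i j f g => mul_pos_of_orbit_eq hU hne horb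
  have hdf := degree_ne_zero hU hne horb hi hf0 hf
  have hdg := degree_ne_zero hU hne horb hj hg0 hg
  refine ⟨σ.leadingCoeff g ^ σ.degree f, ?_, σ.leadingCoeff f ^ σ.degree g, ?_, σ.degree g,
    σ.degree f, pow_ne_zero _ (GaAction.leadingCoeff_ne_zero hg0), hdg, ?_⟩
  · exact ρ.invariants.pow_mem (leadingCoeff_mem_weightSpace hU hne horb g) _
  · exact ρ.invariants.pow_mem (leadingCoeff_mem_weightSpace hU hne horb f) _
  -- The extra factor makes the identity trivial at points where a leading coefficient, `f` or `g`
  -- vanishes.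
  refine mul_left_cancel₀ (mul_ne_zero (mul_ne_zero (GaAction.leadingCoeff_ne_zero (σ := σ) hf0)
    (GaAction.leadingCoeff_ne_zero (σ := σ) hg0)) (mul_ne_zero hf0 hg0))
    (eq_of_value_eq_on_isOpen hU hne fun x hx => ?_)
  rw [value_mul _ (_ * f ^ _), value_mul _ (_ * g ^ _)]
  by_cases h0 : value (σ.leadingCoeff f * σ.leadingCoeff g * (f * g)) x = 0
  · rw [h0, zero_mul, zero_mul]
  congr 1
  simp only [value_mul] at h0
  have hlf := left_ne_zero_of_mul (left_ne_zero_of_mul h0)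
  have hlg := right_ne_zero_of_mul (left_ne_zero_of_mul h0)
  have hfx := left_ne_zero_of_mul (right_ne_zero_of_mul h0)
  have hgx := right_ne_zero_of_mul (right_ne_zero_of_mul h0)
  obtain ⟨r, hr⟩ := GaAction.exists_value_translate_eq_zero hlf hdf
  have hfr := Polynomial.eq_C_mul_X_sub_C_pow_of_forall_root_eq (p := σ.orbitPoly f x) (r := r)
    fun s hs => eq_of_value_translate_eq_zero hsign (horb x hx) hi hi hf hf hfx hfx hlf hr
      (by rw [← σ.eval_orbitPoly]; exact Polynomial.isRoot_of_mem_roots hs)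
  have hgr := Polynomial.eq_C_mul_X_sub_C_pow_of_forall_root_eq (p := σ.orbitPoly g x) (r := r)
    fun s hs => eq_of_value_translate_eq_zero hsign (horb x hx) hi hj hf hg hfx hgx hlf hr
      (by rw [← σ.eval_orbitPoly]; exact Polynomial.isRoot_of_mem_roots hs)
  -- At parameter `0` this reads `f x = lc(f)(x) * (-r) ^ deg f`, and likewise for `g`. The
  -- exponents are chosen so that the powers of `-r` agree.
  have hf1 := congrArg (Polynomial.eval 0) hfr
  have hg1 := congrArg (Polynomial.eval 0) hgr
  rw [σ.eval_zero_orbitPoly, GaAction.leadingCoeff_orbitPoly hlf,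
    GaAction.natDegree_orbitPoly hlf, Polynomial.eval_mul, Polynomial.eval_C, Polynomial.eval_pow,
    Polynomial.eval_sub, Polynomial.eval_X, Polynomial.eval_C] at hf1
  rw [σ.eval_zero_orbitPoly, GaAction.leadingCoeff_orbitPoly hlg,
    GaAction.natDegree_orbitPoly hlg, Polynomial.eval_mul, Polynomial.eval_C, Polynomial.eval_pow,
    Polynomial.eval_sub, Polynomial.eval_X, Polynomial.eval_C] at hg1
  simp only [value_mul, value_pow]
  rw [hf1, hg1, mul_pow, mul_pow, ← pow_mul, ← pow_mul, mul_comm (σ.degree g)]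
  ring

end GmAction

/-! ### The prime ideal of functions without invariant part. -/

theorem isAlgebraic_of_mul_pow_eq {R A : Type*} [CommRing R] [CommRing A] [Algebra R A] {g : A}
    {a c : R} {m : ℕ} (ha : a ≠ 0) (hm : m ≠ 0) (h : algebraMap R A a * g ^ m = algebraMap R A c) :
    IsAlgebraic R g := by
  refine ⟨Polynomial.C a * Polynomial.X ^ m - Polynomial.C c, fun h0 => ha ?_, ?_⟩
  · simpa [Polynomial.coeff_C_of_ne_zero hm] using congrArg (fun p => p.coeff m) h0
  · simp [h]

namespace GmAction

open LaurentPolynomial Points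

variable {K A : Type*} [Field K] [CommRing A] [Algebra K A] [IsAlgClosed K] [CharZero K]
  [IsDomain A] [Algebra.FiniteType K A]

/-- The projection to the algebra of invariants, when all nonzero weights have the same sign. -/
noncomputable def invariantPart (ρ : GmAction K A)
    (hsign : ∀ (i j : ℤ) (f g : A), i ≠ 0 → j ≠ 0 → f ≠ 0 → g ≠ 0 → f ∈ ρ.weightSpace i →
      g ∈ ρ.weightSpace j → 0 < i * j) : A →+* A where
  toFun := ρ.component 0
  map_zero' := by simp [component]
  map_one' := component_of_mem one_mem_weightSpace
  map_add' := ρ.component_add 0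
  map_mul' f g := by
    induction f using ρ.weightSpace_induction with
    | mem i f hf =>
      induction g using ρ.weightSpace_induction with
      | mem j g hg =>
        obtain rfl | hf0 := eq_or_ne f 0
        · simp [component]
        obtain rfl | hg0 := eq_or_ne g 0
        · simp [component]
        obtain rfl | hj := eq_or_ne j 0
        · rw [component_mul_of_mem hg, sub_zero, component_of_mem hg]
        rw [component_mul_of_mem hg, component_of_mem_of_ne hg hj.symm, mul_zero,
          component_of_mem_of_ne hf, zero_mul]
        -- Two nonzero weights cannot cancel, because they have the same sign.
        intro hij
        have hi : i ≠ 0 := by omega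
        have := hsign i j f g hi hj hf0 hg0 hf hg
        rw [← hij] at this
        nlinarith [sq_nonneg j]
      | add g₁ g₂ h₁ h₂ => rw [mul_add, component_add, component_add, h₁, h₂, mul_add]
    | add f₁ f₂ h₁ h₂ => rw [add_mul, component_add, component_add, h₁, h₂, add_mul]

variable {ρ : GmAction K A}

/-- Any function is algebraic over the algebra generated by invariants and one homogeneous
function, when homogeneous functions are multiplicatively dependent up to invariant factors. -/
theorem isAlgebraic_adjoin_singleton {i : ℤ} {f : A} (hi : i ≠ 0) (hf0 : f ≠ 0)
    (hf : f ∈ ρ.weightSpace i)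
    (hdep : ∀ (i j : ℤ) (f g : A), i ≠ 0 → j ≠ 0 → f ≠ 0 → g ≠ 0 → f ∈ ρ.weightSpace i →
      g ∈ ρ.weightSpace j → ∃ a ∈ ρ.weightSpace 0, ∃ b ∈ ρ.weightSpace 0, ∃ m n : ℕ, a ≠ 0 ∧
        m ≠ 0 ∧ a * f ^ m = b * g ^ n) (g : A) :
    IsAlgebraic (Algebra.adjoin ρ.invariants {f}) g := by
  have hinv : ∀ a ∈ ρ.weightSpace 0, a ∈ Algebra.adjoin ρ.invariants {f} := fun a ha =>
    (Algebra.adjoin ρ.invariants {f}).algebraMap_mem ⟨a, ha⟩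
  induction g using ρ.weightSpace_induction with
  | mem j g hg =>
    obtain rfl | hg0 := eq_or_ne g 0
    · exact isAlgebraic_zero
    obtain rfl | hj := eq_or_ne j 0
    · exact isAlgebraic_algebraMap (⟨g, hinv g hg⟩ : Algebra.adjoin ρ.invariants {f})
    obtain ⟨a, ha, b, hb, m, n, ha0, hm, h⟩ := hdep j i g f hj hi hg0 hf0 hg hf
    have hc : b * f ^ n ∈ Algebra.adjoin ρ.invariants {f} :=
      Subalgebra.mul_mem _ (hinv b hb)
        (Subalgebra.pow_mem _ (Algebra.self_mem_adjoin_singleton ρ.invariants f) n)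
    exact isAlgebraic_of_mul_pow_eq (R := Algebra.adjoin ρ.invariants {f}) (a := ⟨a, hinv a ha⟩)
      (c := ⟨b * f ^ n, hc⟩) (fun h0 => ha0 (congrArg Subtype.val h0)) hm h
  | add g₁ g₂ h₁ h₂ => exact h₁.add h₂

/-- Being algebraic, a nonzero element of `q` divides a nonzero `P(f) = f^k Q(f)` with `Q(0) ≠ 0`.
The invariant part of `Q(f)` is `Q(0)`, so `Q(f) ∉ q` and primality leaves `f ∈ q`. -/
theorem mem_of_isPrime_of_le_ker
    (hsign : ∀ (i j : ℤ) (f g : A), i ≠ 0 → j ≠ 0 → f ≠ 0 → g ≠ 0 → f ∈ ρ.weightSpace i →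
      g ∈ ρ.weightSpace j → 0 < i * j) {q : Ideal A} [q.IsPrime] (hq : q ≠ ⊥)
    (hle : q ≤ RingHom.ker (ρ.invariantPart hsign)) {i : ℤ} {f : A} (hi : i ≠ 0)
    (hf : f ∈ ρ.weightSpace i)
    (halg : ∀ g : A, IsAlgebraic (Algebra.adjoin ρ.invariants {f}) g) : f ∈ q := by
  obtain ⟨p, hpq, hp0⟩ := Submodule.exists_mem_ne_zero_of_ne_bot hq
  obtain ⟨r, hr0, hr⟩ := (halg p).exists_nonzero_dvd (mem_nonZeroDivisors_of_ne_zero hp0)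
  have hrq : (r : A) ∈ q := q.mem_of_dvd hr hpq
  obtain ⟨P, hP⟩ : (r : A) ∈ (Polynomial.aeval (R := ρ.invariants) f).range := by
    rw [← Algebra.adjoin_singleton_eq_range_aeval]
    exact r.2
  have hP0 : P ≠ 0 := by
    rintro rfl
    exact hr0 (Subtype.ext (hP.symm.trans (map_zero _)))
  obtain ⟨Q, hQ, hdvd⟩ := Polynomial.exists_eq_pow_rootMultiplicity_mul_and_not_dvd P hP0 0
  rw [Polynomial.C_0, sub_zero] at hQ hdvd
  rw [Polynomial.X_dvd_iff] at hdvd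
  rw [← hP, AlgHom.toRingHom_eq_coe, RingHom.coe_coe, hQ, map_mul, map_pow,
    Polynomial.aeval_X] at hrq
  refine (Ideal.IsPrime.mem_or_mem ‹q.IsPrime› hrq).elim
    (fun h => Ideal.IsPrime.mem_of_pow_mem ‹q.IsPrime› _ h) fun h => ?_
  refine absurd (hle h) fun hker => hdvd (Subtype.ext ?_)
  rw [RingHom.mem_ker] at hker
  rw [← Polynomial.X_mul_divX_add Q, map_add, map_mul, Polynomial.aeval_X, Polynomial.aeval_C,
    map_add, map_mul, show ρ.invariantPart hsign f = 0 from component_of_mem_of_ne hf hi.symm,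
    zero_mul, zero_add] at hker
  exact (component_of_mem (Q.coeff 0).2).symm.trans hker

/-- A nonzero prime inside the kernel contains every function of nonzero weight, hence equals the
kernel. The kernel is nonzero because an effective action has a nonzero weight. -/
theorem height_ker_invariantPart (hρ : ρ.IsEffective)
    (hsign : ∀ (i j : ℤ) (f g : A), i ≠ 0 → j ≠ 0 → f ≠ 0 → g ≠ 0 → f ∈ ρ.weightSpace i →
      g ∈ ρ.weightSpace j → 0 < i * j)
    (hdep : ∀ (i j : ℤ) (f g : A), i ≠ 0 → j ≠ 0 → f ≠ 0 → g ≠ 0 → f ∈ ρ.weightSpace i →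
      g ∈ ρ.weightSpace j → ∃ a ∈ ρ.weightSpace 0, ∃ b ∈ ρ.weightSpace 0, ∃ m n : ℕ, a ≠ 0 ∧
        m ≠ 0 ∧ a * f ^ m = b * g ^ n) :
    (RingHom.ker (ρ.invariantPart hsign)).height = 1 := by
  have hprime : (RingHom.ker (ρ.invariantPart hsign)).IsPrime := RingHom.ker_isPrime _
  apply le_antisymm
  · refine (Ideal.height_le_iff (n := 1)).2 fun q hq hlt => ?_
    suffices q = ⊥ by rw [this, Ideal.height_bot]; exact zero_lt_one
    by_contra hne
    refine hlt.not_ge fun g hg => mem_of_forall_component_mem (ρ := ρ) fun i => ?_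
    obtain rfl | hi := eq_or_ne i 0
    · rw [show ρ.component 0 g = 0 from hg]
      exact zero_mem q
    · by_cases h0 : ρ.component i g = 0
      · rw [h0]
        exact zero_mem q
      exact mem_of_isPrime_of_le_ker hsign hne hlt.le hi (ρ.component_mem i g)
        (isAlgebraic_adjoin_singleton hi h0 (ρ.component_mem i g) hdep)
  · rw [Order.one_le_iff_ne_zero, Ne, Ideal.height_eq_zero_iff_eq_bot]
    intro hbot
    obtain ⟨i, f, hi, hf, hf0⟩ := hρ.exists_mem_weightSpace
    have : f ∈ RingHom.ker (ρ.invariantPart hsign) := component_of_mem_of_ne hf hi.symm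
    rw [hbot] at this
    exact hf0 this

/-- If generic `𝔾ₘ`-orbit closures are `𝔾ₐ`-orbits, then there is a divisor of fixed points. -/
theorem hasFixedPrimeDivisor_of_orbit_eq {σ : GaAction K A} (hρ : ρ.IsEffective)
    {U : Set (Points K A)} (hU : IsOpen U) (hne : U.Nonempty)
    (horb : ∀ x ∈ U, σ.orbit x = closure (ρ.orbit x)) : HasFixedPrimeDivisor ρ := by
  have hsign : ∀ (i j : ℤ) (f g : A), i ≠ 0 → j ≠ 0 → f ≠ 0 → g ≠ 0 → f ∈ ρ.weightSpace i →
      g ∈ ρ.weightSpace j → 0 < i * j := fun i j f g => mul_pos_of_orbit_eq hU hne horb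
  refine ⟨zeroLocus ⟨RingHom.ker (ρ.invariantPart hsign), RingHom.ker_isPrime _⟩, ?_, ?_⟩
  · rw [coheight_zeroLocus]
    exact height_ker_invariantPart hρ hsign fun i j f g => exists_mul_pow_eq_mul_pow hU hne horb
  · intro x hx t
    refine act_eq_self_of_forall fun i f hf => ?_
    obtain rfl | hi := eq_or_ne i 0
    · exact value_act_of_mem_zero hf t x
    · have h0 : value f x = 0 :=
        mem_zeroLocus.1 hx f (component_of_mem_of_ne hf hi.symm : ρ.component 0 f = 0)
      rw [hf t x, h0, mul_zero]

end GmAction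

/-! ### The equivalence and the homogeneous derivation. -/

theorem theorem1 {K : Type*} [Field K] [IsAlgClosed K] [CharZero K]
    {A : Type*} [CommRing A] [IsDomain A] [IsIntegrallyClosed A]
    [Algebra K A] [Algebra.FiniteType K A]
    (ρ : GmAction K A) (hρ : ρ.IsEffective) :
    ((∃ σ : GaAction K A, σ.IsCompatible ρ) ↔ HasFixedPrimeDivisor ρ) ∧
    (HasFixedPrimeDivisor ρ →
      ∃ (σ : GaAction K A) (δ : Derivation K A A), σ.IsCompatible ρ ∧ σ.IsExpOf δ ∧
        δ.IsLocallyNilpotent ∧ δ.IsHomogeneousFor ρ ∧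
        LinearMap.ker (δ : A →ₗ[K] A) = ρ.weightSpace 0) := by
  have hexists : HasFixedPrimeDivisor ρ →
      ∃ (σ : GaAction K A) (δ : Derivation K A A), σ.IsCompatible ρ ∧ σ.IsExpOf δ ∧
        δ.IsLocallyNilpotent ∧ δ.IsHomogeneousFor ρ ∧
        LinearMap.ker (δ : A →ₗ[K] A) = ρ.weightSpace 0 := by
    intro h
    obtain ⟨d, u, hu⟩ := h.exists_isUniformizer hρ
    exact hu.exists_compatible_expAction
  refine ⟨⟨?_, fun h => ?_⟩, hexists⟩
  · rintro ⟨σ, -, U, hU, hne, horb⟩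
    exact GmAction.hasFixedPrimeDivisor_of_orbit_eq hρ hU hne horb
  · obtain ⟨σ, δ, hσ, -⟩ := hexists h
    exact ⟨σ, hσ⟩
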